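/- Let $\mathbb X$ be a category with finite products (terminal object $\ast$, unique morphisms $t_X\colon X\to\ast$, projections $\pi_i$). **Assignments.** A *linear assignment* on $\mathbb X$ is a quadruple $(\mathcal L,+,0,\nu)$ consisting of an endofunctor $\mathcal L\colon\mathbb X\to\mathbb X$ which preserves finite products, natural transformations $+_X\colon\mathcal L(X)\times\mathcal L(X)\to\mathcal L(X)$ and $0_X\colon\ast\to\mathcal L(X)$, and a natural isomorphism $\nu_X\colon\mathcal L\mathcal L(X)\to\mathcal L(X)$, such that for every object $X$: (i) $\mathsf L(X)=(\mathcal L(X),+_X,0_X)$ is a commutative monoid object; (ii) $\nu_X\colon\mathsf L(\mathcal L(X))\to\mathsf L(X)$ is a morphism of monoids; (iii) $\nu_{\mathcal L(X)}=\mathcal L(\nu_X)$. It is an *additive assignment* if moreover it is equipped with a natural transformation $-_X\colon\mathcal L(X)\to\mathcal L(X)$ making every $\mathsf L(X)$ an abelian group object. An *$\mathcal L$-algebra* is a pair $(A,\mathsf a)$ of an object $A$ and an isomorphism $\mathsf a\colon\mathcal L(A)\to A$ with $\mathcal L(\mathsf a)=\nu_A$; a morphism $f\colon(A,\mathsf a)\to(A',\mathsf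 a')$ is a morphism $f\colon A\to A'$ with $\mathsf a'\circ\mathcal L(f)=f\circ\mathsf a$. These form the category $\mathcal L\text{-}\mathsf{ALG}$. **Bundles.** A *bundle* is a morphism $q\colon E\to X$ such that for all $n\in\mathbb N$ the pullback $E_n$ of $n$ copies of $q$ exists, with projections $\rho_j\colon E_n\to E$. An *additive bundle* is a bundle with morphisms $\sigma\colon E_2\to E$ and $\zeta\colon X\to E$ over $X$ satisfying the axioms of a commutative monoid over $X$. A morphism of additive bundles $(f,g)$ from $(q\colon E\to X,\sigma,\zeta)$ to $(q'\colon E'\to X',\sigma',\zeta')$ consists of $f\colon E\to E'$ and $g\colon X\to X'$ with $q'f=gq$, $\sigma'\langle f\rho_1,f\rho_2\rangle=f\sigma$ and $f\zeta=\zeta'g$. **Tangent structures.** A *tangent structure* $(\mathcal T,\mathsf p,\mathsf s,\mathsf z,\ell,\mathsf c)$ on a category consists of an endofunctor $\mathcal T$ and natural transformations $\mathsf p_X\colon\mathcal T(X)\to X$, $\mathsf s_X\colon\mathcal T_2(X)\to\mathcal T(X)$ (where $\mathcal T_n(X)$ is the pullback of $n$ copies of $\mathsf p_X$, required to exist and to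 be preserved by every $\mathcal T^m$), $\mathsf z_X\colon X\to\mathcal T(X)$, $\ell_X\colon\mathcal T(X)\to\mathcal T\mathcal T(X)$ and $\mathsf c_X\colon\mathcal T\mathcal T(X)\to\mathcal T\mathcal T(X)$, such that: * $\mathsf T(X)=(\mathsf p_X,\mathsf s_X,\mathsf z_X)$ is an additive bundle; $(\ell_X,\mathsf z_X)\colon\mathsf T(X)\to\mathcal T(\mathsf T(X))$ and $(\mathsf c_X,1)\colon\mathcal T(\mathsf T(X))\to\mathsf T(\mathcal T(X))$ are additive bundle morphisms; * $\ell_{\mathcal T(X)}\ell_X=\mathcal T(\ell_X)\ell_X$, $\mathsf c_X\mathsf c_X=1$, $\mathcal T(\mathsf c_X)\,\mathsf c_{\mathcal T(X)}\,\mathcal T(\mathsf c_X)=\mathsf c_{\mathcal T(X)}\,\mathcal T(\mathsf c_X)\,\mathsf c_{\mathcal T(X)}$, $\mathsf c_X\ell_X=\ell_X$ and $\mathsf c_{\mathcal T(X)}\,\mathcal T(\mathsf c_X)\,\ell_{\mathcal T(X)}=\mathcal T(\ell_X)\,\mathsf c_X$; * the square with top $\mathcal T(\mathsf s_X)\circ\langle\ell_X\rho_1,\mathsf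 z_{\mathcal T(X)}\rho_2\rangle\colon\mathcal T_2(X)\to\mathcal T\mathcal T(X)$, left $\mathsf p_X\rho_1$, right $\mathcal T(\mathsf p_X)$ and bottom $\mathsf z_X$ is a pullback. A *Rosický tangent structure* has in addition a natural transformation $\mathsf n_X\colon\mathcal T(X)\to\mathcal T(X)$ over $X$ which is a negative for each $\mathsf T(X)$. A *differential bundle* over $X$ consists of an additive bundle $\mathsf E=(q\colon E\to X,\sigma,\zeta)$ all of whose pullback powers $E_n$ are preserved by every $\mathcal T^m$, and a morphism $\lambda\colon E\to\mathcal T(E)$ such that $(\lambda,\mathsf z_X)\colon\mathsf E\to\mathcal T(\mathsf E)$ and $(\lambda,\zeta)\colon\mathsf E\to\mathsf T(E)$ are additive bundle morphisms, $\mathcal T(\lambda)\lambda=\ell_E\lambda$, and the square with top $\mathcal T(\sigma)\circ\langle\lambda\rho_1,\mathsf z_E\rho_2\rangle\colon E_2\to\mathcal T(E)$, left $q\rho_1$, right $\mathcal T(q)$ and bottom $\mathsf z_X$ is a pullback which is preserved by every $\mathcal T^m$. A linear bundle morphism over $X$ from $(\mathsf E,\lambda)$ to $(\mathsf E',\lambda')$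 is a morphism $f\colon E\to E'$ with $q'f=q$ and $\mathcal T(f)\lambda=\lambda'f$. When $\mathcal T$ preserves finite products, the category $\mathsf{DO}[(\mathbb X,\mathbb T)]$ of *differential objects* is the category of differential bundles over $\ast$ and linear bundle morphisms over $\ast$. Here the pullbacks $E_n$ are chosen once and for all and are not part of the data of an object. (In the Rosický case the same notion of differential bundle is used, for the underlying tangent structure.) **The tangent structure of an assignment.** For a linear assignment $\mathcal L$, let $\omega_{X,Y}=\langle\mathcal L(\pi_1),\mathcal L(\pi_2)\rangle\colon\mathcal L(X\times Y)\to\mathcal L(X)\times\mathcal L(Y)$, and let $\mathbb T_{\mathcal L}$ be the tangent structure on $\mathbb X$ with $\mathcal T(X)=X\times\mathcal L(X)$, $\mathcal T(f)=f\times\mathcal L(f)$, $\mathsf p_X=\pi_1$, $\mathsf z_X=\langle 1_X,0_X t_X\rangle$, with sum $1_X\times{+_X}$ (using $\mathcal T_2(X)\cong X\times(\mathcal L(X)\times\mathcal L(X))$), with $$\ell_X=(1_{X\times\mathcal L(X)}\times\omega_{X,\mathcal L(X)}^{-1})\circ\bigl(\langle 1_X,0_Xt_X\rangle\times\langle 0_Xt_{\mathcal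 L(X)},\nu_X^{-1}\rangle\bigr),$$ $$\mathsf c_X=(1_{X\times\mathcal L(X)}\times\omega_{X,\mathcal L(X)}^{-1})\circ\tau\circ(1_{X\times\mathcal L(X)}\times\omega_{X,\mathcal L(X)}),$$ where $\tau$ exchanges the two middle factors of $(X\times\mathcal L(X))\times(\mathcal L(X)\times\mathcal L\mathcal L(X))$. If $\mathcal L$ is an additive assignment, $\mathsf n_X=1_X\times(-_X)$ makes $\mathbb T_{\mathcal L}$ a Rosický tangent structure. The functor $\mathcal T$ preserves finite products. **Theorem.** Let $\mathcal L$ be a linear (resp. additive) assignment on a category $\mathbb X$ with finite products, and let $\mathbb T_{\mathcal L}$ be the induced tangent (resp. Rosický tangent) structure. Then there is an isomorphism of categories $$\mathsf{DO}[(\mathbb X,\mathbb T_{\mathcal L})]\;\cong\;\mathcal L\text{-}\mathsf{ALG}.$$ -/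

import Mathlib

open CategoryTheory Limits MonoidalCategory CartesianMonoidalCategory MonObj

universe v u

noncomputable section

namespace TangentCat

section Bundles

variable {C : Type u} [Category.{v} C]

/-- The diagram consisting of `n` copies of `q : E ⟶ X`; its limit is the pullback `E_n`
of `n` copies of `q`. -/
abbrev powDiagram {E X : C} (q : E ⟶ X) (n : ℕ) : WidePullbackShape (Fin n) ⥤ C :=
  WidePullbackShape.wideCospan X (fun _ : Fin n => E) (fun _ => q)

/-- A bundle is a morphism `q : E ⟶ X` all of whose finite pullback powers `E_n` exist. -/
structure IsBundle {E X : C} (q : E ⟶ X) : Prop where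
  hasPow (n : ℕ) : HasLimit (powDiagram q n)

namespace IsBundle

variable {E X W V : C} {q : E ⟶ X} (hq : IsBundle q)

/-- The pullback `E_n` of `n` copies of `q`. -/
def pow (n : ℕ) : C :=
  haveI := hq.hasPow n
  widePullback X (fun _ : Fin n => E) (fun _ => q)

/-- The projections `E_n ⟶ E`. -/
def ρ (n : ℕ) (j : Fin n) : hq.pow n ⟶ E :=
  haveI := hq.hasPow n
  WidePullback.π (fun _ : Fin n => q) j

/-- The projection `E_n ⟶ X`. -/
def base (n : ℕ) : hq.pow n ⟶ X :=
  haveI := hq.hasPow n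
  WidePullback.base (fun _ : Fin n => q)

theorem ρ_comp (n : ℕ) (j : Fin n) : hq.ρ n j ≫ q = hq.base n :=
  haveI := hq.hasPow n
  WidePullback.π_arrow (fun _ : Fin n => q) j

theorem ρ_comp_eq (n : ℕ) (i j : Fin n) : hq.ρ n i ≫ q = hq.ρ n j ≫ q := by
  rw [ρ_comp, ρ_comp]

/-- The morphism into `E_n` with prescribed components. -/
def lift {n : ℕ} (b : W ⟶ X) (a : Fin n → (W ⟶ E)) (h : ∀ j, a j ≫ q = b) : W ⟶ hq.pow n :=
  haveI := hq.hasPow n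
  WidePullback.lift b a h

theorem lift_ρ {n : ℕ} (b : W ⟶ X) (a : Fin n → (W ⟶ E)) (h : ∀ j, a j ≫ q = b) (j : Fin n) :
    hq.lift b a h ≫ hq.ρ n j = a j :=
  haveI := hq.hasPow n
  WidePullback.lift_π (fun _ : Fin n => q) b a h j

theorem pow_ext {n : ℕ} [NeZero n] {f g : W ⟶ hq.pow n}
    (h : ∀ j, f ≫ hq.ρ n j = g ≫ hq.ρ n j) : f = g := by
  have := hq.hasPow n
  refine WidePullback.hom_ext (fun _ : Fin n => q) f g h ?_
  have h0 := congrArg (· ≫ q) (h 0)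
  simp only [Category.assoc, hq.ρ_comp] at h0
  exact h0

/-- The pairing `⟨a, b⟩ : W ⟶ E_2`. -/
def pair (a b : W ⟶ E) (h : a ≫ q = b ≫ q) : W ⟶ hq.pow 2 :=
  hq.lift (a ≫ q) ![a, b] (by intro j; fin_cases j <;> simp [h])

theorem pair_ρ0 (a b : W ⟶ E) (h : a ≫ q = b ≫ q) : hq.pair a b h ≫ hq.ρ 2 0 = a :=
  hq.lift_ρ _ _ _ 0

theorem pair_ρ1 (a b : W ⟶ E) (h : a ≫ q = b ≫ q) : hq.pair a b h ≫ hq.ρ 2 1 = b :=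
  hq.lift_ρ _ _ _ 1

theorem pow2_ext {f g : W ⟶ hq.pow 2} (h0 : f ≫ hq.ρ 2 0 = g ≫ hq.ρ 2 0)
    (h1 : f ≫ hq.ρ 2 1 = g ≫ hq.ρ 2 1) : f = g :=
  hq.pow_ext (by intro j; fin_cases j; exacts [h0, h1])

theorem comp_pair (k : V ⟶ W) (a b : W ⟶ E) (h : a ≫ q = b ≫ q) :
    k ≫ hq.pair a b h = hq.pair (k ≫ a) (k ≫ b) (by simp [h]) := by
  apply hq.pow2_ext <;> simp only [Category.assoc, pair_ρ0, pair_ρ1]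

end IsBundle

/-- The iterates `F^m` of an endofunctor. -/
def iter (F : C ⥤ C) : ℕ → (C ⥤ C)
  | 0 => 𝟭 C
  | m + 1 => iter F m ⋙ F

/-- The functor `F` preserves all the pullback powers of `q`. -/
structure PreservesPow (F : C ⥤ C) {E X : C} (q : E ⟶ X) : Prop where
  preserves (n : ℕ) : PreservesLimit (powDiagram q n) F

namespace PreservesPow

variable {F : C ⥤ C} {E X W : C} {q : E ⟶ X} (hF : PreservesPow F q) (hq : IsBundle q)

/-- The image under `F` of the pullback `E_n` is a pullback of `n` copies of `F(q)`. -/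
def isLimit (n : ℕ) :
    haveI := hq.hasPow n
    IsLimit (F.mapCone (limit.cone (powDiagram q n))) :=
  haveI := hq.hasPow n
  haveI := hF.preserves n
  isLimitOfPreserves F (limit.isLimit (powDiagram q n))

/-- The morphism into `F(E_n)` with prescribed components. -/
def lift {n : ℕ} (b : W ⟶ F.obj X) (a : Fin n → (W ⟶ F.obj E)) (h : ∀ j, a j ≫ F.map q = b) :
    W ⟶ F.obj (hq.pow n) :=
  (hF.isLimit hq n).lift (WidePullbackShape.mkCone (F := powDiagram q n ⋙ F) b a h)

theorem lift_ρ {n : ℕ} (b : W ⟶ F.obj X) (a : Fin n → (W ⟶ F.obj E))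
    (h : ∀ j, a j ≫ F.map q = b) (j : Fin n) :
    hF.lift hq b a h ≫ F.map (hq.ρ n j) = a j :=
  (hF.isLimit hq n).fac (WidePullbackShape.mkCone (F := powDiagram q n ⋙ F) b a h) (some j)

theorem pow_ext (hF : PreservesPow F q) (hq : IsBundle q) {n : ℕ} [NeZero n]
    {f g : W ⟶ F.obj (hq.pow n)} (h : ∀ j, f ≫ F.map (hq.ρ n j) = g ≫ F.map (hq.ρ n j)) : f = g := by
  refine (hF.isLimit hq n).hom_ext ?_
  rintro (_ | j)
  · have h0 := congrArg (· ≫ F.map q) (h 0)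
    simp only [Category.assoc, ← F.map_comp, hq.ρ_comp] at h0
    exact h0
  · exact h j

theorem of_iter (h : ∀ m, PreservesPow (iter F m) q) : PreservesPow F q := h 1

theorem isBundle (hF : PreservesPow F q) (hq : IsBundle q) : IsBundle (F.map q) where
  hasPow n := ⟨⟨⟨WidePullbackCone.mk (F.map (hq.base n)) (fun j => F.map (hq.ρ n j))
    (fun j => by rw [← F.map_comp, hq.ρ_comp]),
    WidePullbackCone.IsLimit.mk _
      (fun t => hF.lift hq t.base t.π t.condition)
      (fun t => (hF.isLimit hq n).fac
        (WidePullbackShape.mkCone (F := powDiagram q n ⋙ F) t.base t.π t.condition) none)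
      (fun t j => hF.lift_ρ hq t.base t.π t.condition j)
      (fun t m h1 h2 => (hF.isLimit hq n).hom_ext (by
        rintro (_ | j)
        · exact h1.trans ((hF.isLimit hq n).fac
            (WidePullbackShape.mkCone (F := powDiagram q n ⋙ F) t.base t.π t.condition) none).symm
        · exact (h2 j).trans (hF.lift_ρ hq t.base t.π t.condition j).symm))⟩⟩⟩

/-- The pairing `⟨a, b⟩ : W ⟶ F(E_2)`. -/
def pair (a b : W ⟶ F.obj E) (h : a ≫ F.map q = b ≫ F.map q) : W ⟶ F.obj (hq.pow 2) :=
  hF.lift hq (a ≫ F.map q) ![a, b] (by intro j; fin_cases j <;> simp [h])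

theorem pair_ρ0 (a b : W ⟶ F.obj E) (h : a ≫ F.map q = b ≫ F.map q) :
    hF.pair hq a b h ≫ F.map (hq.ρ 2 0) = a :=
  hF.lift_ρ hq _ _ _ 0

theorem pair_ρ1 (a b : W ⟶ F.obj E) (h : a ≫ F.map q = b ≫ F.map q) :
    hF.pair hq a b h ≫ F.map (hq.ρ 2 1) = b :=
  hF.lift_ρ hq _ _ _ 1

theorem pow2_ext (hF : PreservesPow F q) (hq : IsBundle q) {f g : W ⟶ F.obj (hq.pow 2)}
    (h0 : f ≫ F.map (hq.ρ 2 0) = g ≫ F.map (hq.ρ 2 0))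
    (h1 : f ≫ F.map (hq.ρ 2 1) = g ≫ F.map (hq.ρ 2 1)) : f = g :=
  hF.pow_ext hq (by intro j; fin_cases j; exacts [h0, h1])

theorem comp_pair {V : C} (k : V ⟶ W) (a b : W ⟶ F.obj E) (h : a ≫ F.map q = b ≫ F.map q) :
    k ≫ hF.pair hq a b h = hF.pair hq (k ≫ a) (k ≫ b) (by simp [h]) := by
  apply hF.pow2_ext hq <;> simp only [Category.assoc, pair_ρ0, pair_ρ1]

theorem pair_eq {V : C} (t : W ⟶ F.obj V) {a b : W ⟶ F.obj E}
    (h : a ≫ F.map q = b ≫ F.map q) {a' b' : V ⟶ E} (h' : a' ≫ q = b' ≫ q)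
    (ha : a = t ≫ F.map a') (hb : b = t ≫ F.map b') :
    hF.pair hq a b h = t ≫ F.map (hq.pair a' b' h') := by
  apply hF.pow2_ext hq <;>
    simp only [pair_ρ0, pair_ρ1, Category.assoc, ← F.map_comp,
      IsBundle.pair_ρ0, IsBundle.pair_ρ1, ha, hb]

theorem pair_pair (hq' : IsBundle (F.map q)) (a b : W ⟶ F.obj E)
    (h : a ≫ F.map q = b ≫ F.map q) :
    hq'.pair a b h ≫ hF.pair hq (hq'.ρ 2 0) (hq'.ρ 2 1) (hq'.ρ_comp_eq 2 0 1) =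
      hF.pair hq a b h := by
  apply hF.pow2_ext hq <;>
    simp only [pair_ρ0, pair_ρ1, Category.assoc, IsBundle.pair_ρ0, IsBundle.pair_ρ1]

end PreservesPow

/-- An additive bundle with projection `q : E ⟶ X`: a commutative monoid over `X`. -/
@[ext]
structure AdditiveBundle {E X : C} (q : E ⟶ X) where
  isBundle : IsBundle q
  add : isBundle.pow 2 ⟶ E
  zero : X ⟶ E
  add_proj : ∀ j, add ≫ q = isBundle.ρ 2 j ≫ q
  zero_proj : zero ≫ q = 𝟙 X
  add_assoc :
    isBundle.pair
        (isBundle.pair (isBundle.ρ 3 0) (isBundle.ρ 3 1) (isBundle.ρ_comp_eq 3 0 1) ≫ add)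
        (isBundle.ρ 3 2)
        (by rw [Category.assoc, add_proj 0, ← Category.assoc, IsBundle.pair_ρ0]
            exact isBundle.ρ_comp_eq 3 0 2) ≫ add =
      isBundle.pair
        (isBundle.ρ 3 0)
        (isBundle.pair (isBundle.ρ 3 1) (isBundle.ρ 3 2) (isBundle.ρ_comp_eq 3 1 2) ≫ add)
        (by rw [Category.assoc, add_proj 0, ← Category.assoc, IsBundle.pair_ρ0]
            exact isBundle.ρ_comp_eq 3 0 1) ≫ add
  zero_add : isBundle.pair (q ≫ zero) (𝟙 E) (by simp [zero_proj]) ≫ add = 𝟙 E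
  add_zero : isBundle.pair (𝟙 E) (q ≫ zero) (by simp [zero_proj]) ≫ add = 𝟙 E
  add_comm : isBundle.pair (isBundle.ρ 2 1) (isBundle.ρ 2 0) (isBundle.ρ_comp_eq 2 1 0) ≫ add = add

namespace AdditiveBundle

variable {E X E' X' W : C} {q : E ⟶ X} {q' : E' ⟶ X'}

/-- Morphisms of additive bundles. -/
structure IsHom (B : AdditiveBundle q) (B' : AdditiveBundle q') (f : E ⟶ E') (g : X ⟶ X') :
    Prop where
  w : f ≫ q' = q ≫ g
  add : B'.isBundle.pair (B.isBundle.ρ 2 0 ≫ f) (B.isBundle.ρ 2 1 ≫ f)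
      (by rw [Category.assoc, Category.assoc, w, ← Category.assoc, ← Category.assoc,
            B.isBundle.ρ_comp_eq 2 0 1]) ≫ B'.add = B.add ≫ f
  zero : B.zero ≫ f = g ≫ B'.zero

/-- The additive bundle `F(E)` over `F(X)`, whose sum and zero are the images under `F` of
the sum and zero of `E`, for a functor `F` which preserves the pullback powers of `q`. -/
def map (B : AdditiveBundle q) (F : C ⥤ C) (hF : PreservesPow F q) :
    AdditiveBundle (F.map q) where
  isBundle := hF.isBundle B.isBundle
  add := hF.pair B.isBundle ((hF.isBundle B.isBundle).ρ 2 0) ((hF.isBundle B.isBundle).ρ 2 1)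
    ((hF.isBundle B.isBundle).ρ_comp_eq 2 0 1) ≫ F.map B.add
  zero := F.map B.zero
  add_proj j := by
    rw [(hF.isBundle B.isBundle).ρ_comp_eq 2 j 0, Category.assoc, ← F.map_comp, B.add_proj 0,
      F.map_comp, ← Category.assoc, PreservesPow.pair_ρ0]
  zero_proj := by rw [← F.map_comp, B.zero_proj, F.map_id]
  add_assoc := by
    have hq := hF.isBundle B.isBundle
    let t : hq.pow 3 ⟶ F.obj (B.isBundle.pow 3) :=
      hF.lift B.isBundle (hq.base 3) (fun j => hq.ρ 3 j) (fun j => hq.ρ_comp 3 j)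
    have ht : ∀ j, hq.ρ 3 j = t ≫ F.map (B.isBundle.ρ 3 j) :=
      fun j => (hF.lift_ρ _ _ _ _ j).symm
    have h01 := hF.pair_eq B.isBundle t (hq.ρ_comp_eq 3 0 1) (B.isBundle.ρ_comp_eq 3 0 1)
      (ht 0) (ht 1)
    have h12 := hF.pair_eq B.isBundle t (hq.ρ_comp_eq 3 1 2) (B.isBundle.ρ_comp_eq 3 1 2)
      (ht 1) (ht 2)
    have e := congrArg (fun k => t ≫ F.map k) B.add_assoc
    simp only [F.map_comp] at e
    simp only [← Category.assoc, PreservesPow.pair_pair]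
    refine Eq.trans ?_ ((Category.assoc _ _ _).trans
      (e.trans ((Category.assoc _ _ _).symm.trans ?_)))
    · congr 1
      refine hF.pair_eq B.isBundle t _ _ ?_ (ht 2)
      rw [h01, Category.assoc, F.map_comp]
    · congr 1
      refine (hF.pair_eq B.isBundle t _ _ (ht 0) ?_).symm
      rw [h12, Category.assoc, F.map_comp]
  zero_add := by
    rw [← Category.assoc, PreservesPow.pair_pair,
      hF.pair_eq B.isBundle (𝟙 _) _ (a' := q ≫ B.zero) (b' := 𝟙 E) (by simp [B.zero_proj])
        (by simp) (by simp), Category.id_comp, ← F.map_comp, B.zero_add, F.map_id]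
  add_zero := by
    rw [← Category.assoc, PreservesPow.pair_pair,
      hF.pair_eq B.isBundle (𝟙 _) _ (a' := 𝟙 E) (b' := q ≫ B.zero) (by simp [B.zero_proj])
        (by simp) (by simp), Category.id_comp, ← F.map_comp, B.add_zero, F.map_id]
  add_comm := by
    have hq := hF.isBundle B.isBundle
    rw [← Category.assoc, PreservesPow.pair_pair,
      hF.pair_eq B.isBundle
        (hF.pair B.isBundle (hq.ρ 2 0) (hq.ρ 2 1) (hq.ρ_comp_eq 2 0 1)) _
        (B.isBundle.ρ_comp_eq 2 1 0) (PreservesPow.pair_ρ1 ..).symm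
        (PreservesPow.pair_ρ0 ..).symm, Category.assoc, ← F.map_comp, B.add_comm]

theorem map_pair_add (B : AdditiveBundle q) (F : C ⥤ C) (hF : PreservesPow F q)
    (a b : W ⟶ F.obj E) (h : a ≫ F.map q = b ≫ F.map q) :
    (B.map F hF).isBundle.pair a b h ≫ (B.map F hF).add =
      hF.pair B.isBundle a b h ≫ F.map B.add := by
  change _ ≫ hF.pair B.isBundle _ _ _ ≫ F.map B.add = _
  rw [← Category.assoc, PreservesPow.pair_pair]

/-- The morphism `F(•) ∘ ⟨u ∘ ρ₁, v ∘ ρ₂⟩ : E_2 ⟶ F(E)`, where `u` and `v` are morphisms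
`E ⟶ F(E)` over a common morphism `z : X ⟶ F(X)`. -/
def vertical (B : AdditiveBundle q) (F : C ⥤ C) (hF : PreservesPow F q) (u v : E ⟶ F.obj E)
    (z : X ⟶ F.obj X) (hu : u ≫ F.map q = q ≫ z) (hv : v ≫ F.map q = q ≫ z) :
    B.isBundle.pow 2 ⟶ F.obj E :=
  hF.pair B.isBundle (B.isBundle.ρ 2 0 ≫ u) (B.isBundle.ρ 2 1 ≫ v)
    (by rw [Category.assoc, Category.assoc, hu, hv, ← Category.assoc, ← Category.assoc,
          B.isBundle.ρ_comp_eq 2 0 1]) ≫ F.map B.add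

end AdditiveBundle

variable (C) in
/-- A tangent structure `(T, p, s, z, ℓ, c)` on a category; the sum `s` and the zero `z` are
the components `add` and `zero` of the additive bundles `bun X` with projections `p X`. -/
structure TangentStructure where
  /-- the tangent bundle functor -/
  T : C ⥤ C
  /-- the projection -/
  p (X : C) : T.obj X ⟶ X
  /-- the additive bundle `(p, s, z)` over `X` -/
  bun (X : C) : AdditiveBundle (p X)
  /-- all powers of `T` preserve the pullback powers of the projections -/
  preservesPow (X : C) (m : ℕ) : PreservesPow (iter T m) (p X)
  /-- naturality of `p`, `s` and `z` -/
  bun_naturality {X Y : C} (f : X ⟶ Y) : (bun X).IsHom (bun Y) (T.map f) f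
  /-- the vertical lift -/
  l (X : C) : T.obj X ⟶ T.obj (T.obj X)
  l_naturality {X Y : C} (f : X ⟶ Y) : T.map f ≫ l Y = l X ≫ T.map (T.map f)
  l_isHom (X : C) : (bun X).IsHom ((bun X).map T (.of_iter (preservesPow X))) (l X) (bun X).zero
  l_l (X : C) : l X ≫ l (T.obj X) = l X ≫ T.map (l X)
  /-- universality of the vertical lift -/
  l_universal (X : C) : IsPullback
    ((bun X).vertical T (.of_iter (preservesPow X)) (l X) (bun (T.obj X)).zero (bun X).zero
      (l_isHom X).w (bun_naturality (p X)).zero)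
    ((bun X).isBundle.ρ 2 0 ≫ p X) (T.map (p X)) (bun X).zero
  /-- the canonical flip -/
  c (X : C) : T.obj (T.obj X) ⟶ T.obj (T.obj X)
  c_naturality {X Y : C} (f : X ⟶ Y) :
    T.map (T.map f) ≫ c Y = c X ≫ T.map (T.map f)
  c_c (X : C) : c X ≫ c X = 𝟙 _
  yang_baxter (X : C) :
    T.map (c X) ≫ c (T.obj X) ≫ T.map (c X) = c (T.obj X) ≫ T.map (c X) ≫ c (T.obj X)
  c_isHom (X : C) :
    ((bun X).map T (.of_iter (preservesPow X))).IsHom (bun (T.obj X)) (c X) (𝟙 (T.obj X))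
  l_c (X : C) : l X ≫ c X = l X
  l_c_c (X : C) : l (T.obj X) ≫ T.map (c X) ≫ c (T.obj X) = c X ≫ T.map (l X)

variable (C) in
/-- A Rosický tangent structure: a tangent structure with a negative `n`, which makes the
additive bundles `bun X` into abelian group bundles. -/
structure RosickyTangentStructure extends TangentStructure C where
  n (X : C) : T.obj X ⟶ T.obj X
  n_naturality {X Y : C} (f : X ⟶ Y) : T.map f ≫ n Y = n X ≫ T.map f
  n_proj (X : C) : n X ≫ p X = p X
  add_n (X : C) : (bun X).isBundle.pair (𝟙 _) (n X) (by rw [n_proj, Category.id_comp]) ≫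
    (bun X).add = p X ≫ (bun X).zero
  n_add (X : C) : (bun X).isBundle.pair (n X) (𝟙 _) (by rw [n_proj, Category.id_comp]) ≫
    (bun X).add = p X ≫ (bun X).zero

/-- A differential bundle over `X` in a tangent category. -/
structure DifferentialBundle (𝕋 : TangentStructure C) (X : C) where
  E : C
  /-- the projection -/
  q : E ⟶ X
  /-- the sum and the zero -/
  bun : AdditiveBundle q
  /-- all powers of `T` preserve the pullback powers of the projection -/
  preservesPow (m : ℕ) : PreservesPow (iter 𝕋.T m) q
  /-- the lift -/
  lift : E ⟶ 𝕋.T.obj E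
  lift_isHom_map : bun.IsHom (bun.map 𝕋.T (.of_iter preservesPow)) lift (𝕋.bun X).zero
  lift_isHom_bun : bun.IsHom (𝕋.bun E) lift bun.zero
  lift_lift : lift ≫ 𝕋.T.map lift = lift ≫ 𝕋.l E
  /-- the universality square of the lift is a pullback, preserved by all powers of `T` -/
  universal (m : ℕ) : IsPullback
    ((iter 𝕋.T m).map (bun.vertical 𝕋.T (.of_iter preservesPow) lift (𝕋.bun E).zero (𝕋.bun X).zero
      lift_isHom_map.w (𝕋.bun_naturality q).zero))
    ((iter 𝕋.T m).map (bun.isBundle.ρ 2 0 ≫ q))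
    ((iter 𝕋.T m).map (𝕋.T.map q))
    ((iter 𝕋.T m).map (𝕋.bun X).zero)

namespace DifferentialBundle

variable {𝕋 : TangentStructure C} {X : C}

/-- Linear bundle morphisms over `X`: morphisms over `X` which commute with the lifts. -/
@[ext]
structure Hom (D D' : DifferentialBundle 𝕋 X) where
  hom : D.E ⟶ D'.E
  w : hom ≫ D'.q = D.q
  lift_comm : D.lift ≫ 𝕋.T.map hom = hom ≫ D'.lift

/-- The category of differential bundles over `X` and linear bundle morphisms over `X`. -/
instance : Category.{v} (DifferentialBundle 𝕋 X) where
  Hom := Hom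
  id D := ⟨𝟙 _, by simp, by simp⟩
  comp f g := ⟨f.hom ≫ g.hom, by simp [f.w, g.w], by
    rw [Functor.map_comp, ← Category.assoc, f.lift_comm, Category.assoc, g.lift_comm,
      Category.assoc]⟩
  id_comp f := Hom.ext (Category.id_comp _)
  comp_id f := Hom.ext (Category.comp_id _)
  assoc f g h := Hom.ext (Category.assoc _ _ _)

end DifferentialBundle

/-- The category of differential objects of a cartesian tangent category: the differential
bundles over the terminal object and the linear bundle morphisms over it. -/
abbrev DifferentialObject [CartesianMonoidalCategory C] (𝕋 : TangentStructure C)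
    [PreservesFiniteProducts 𝕋.T] :=
  DifferentialBundle 𝕋 (𝟙_ C)

end Bundles

section Products

variable {C : Type u} [Category.{v} C] [CartesianMonoidalCategory C]

instance (F : C ⥤ C) [PreservesFiniteProducts F] (A B : C) :
    IsIso (CartesianMonoidalCategory.prodComparison F A B) :=
  isIso_prodComparison_of_preservesLimit_pair F A B

theorem map_ext (F : C ⥤ C) [PreservesFiniteProducts F] {W A B : C} {f g : W ⟶ F.obj (A ⊗ B)}
    (h1 : f ≫ F.map (fst A B) = g ≫ F.map (fst A B))
    (h2 : f ≫ F.map (snd A B) = g ≫ F.map (snd A B)) : f = g := by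
  rw [← cancel_mono (CartesianMonoidalCategory.prodComparison F A B)]
  ext <;> simpa

theorem tensor_pi_ext {n : ℕ} {W X Y : C} {m m' : W ⟶ X ⊗ ∏ᶜ fun _ : Fin n => Y}
    (h1 : m ≫ fst _ _ = m' ≫ fst _ _)
    (h2 : ∀ j, m ≫ X ◁ Pi.π (fun _ : Fin n => Y) j = m' ≫ X ◁ Pi.π (fun _ : Fin n => Y) j) :
    m = m' := by
  refine CartesianMonoidalCategory.hom_ext _ _ h1 (Pi.hom_ext _ _ fun j => ?_)
  have := congrArg (· ≫ snd X Y) (h2 j)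
  simpa using this

/-- The limit cone exhibiting `X ⊗ Y ^ n` as the pullback of `n` copies of `X ⊗ Y ⟶ X`. -/
def fstCone (X Y : C) (n : ℕ) : WidePullbackCone (fun _ : Fin n => fst X Y) :=
  WidePullbackCone.mk (fst X (∏ᶜ fun _ : Fin n => Y)) (fun j => X ◁ Pi.π (fun _ : Fin n => Y) j)
    (fun j => by simp)

def fstConeIsLimit (X Y : C) (n : ℕ) : IsLimit (fstCone X Y n) :=
  WidePullbackCone.IsLimit.mk _
    (fun t => CartesianMonoidalCategory.lift t.base (Pi.lift fun j => t.π j ≫ snd X Y))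
    (fun t => lift_fst _ _)
    (fun t j => by
      change CartesianMonoidalCategory.lift _ _ ≫ X ◁ _ = _
      have := t.condition j
      ext <;> simp [this])
    (fun t m h1 h2 => by
      refine tensor_pi_ext (h1.trans (lift_fst _ _).symm) fun j => (h2 j).trans ?_
      have := t.condition j
      ext <;> simp [this])

theorem isBundle_fst (X Y : C) : IsBundle (fst X Y) where
  hasPow n := ⟨⟨⟨_, fstConeIsLimit X Y n⟩⟩⟩

theorem map_pi_ext (F : C ⥤ C) [PreservesFiniteProducts F] {n : ℕ} {W Y : C}
    {f g : W ⟶ F.obj (∏ᶜ fun _ : Fin n => Y)}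
    (h : ∀ j, f ≫ F.map (Pi.π (fun _ : Fin n => Y) j) = g ≫ F.map (Pi.π (fun _ => Y) j)) :
    f = g := by
  rw [← cancel_mono (piComparison F fun _ : Fin n => Y)]
  ext j
  simpa using h j

theorem exists_map_lift (F : C ⥤ C) [PreservesFiniteProducts F] {n : ℕ} {W X Y : C}
    (b : W ⟶ F.obj X) (a : Fin n → (W ⟶ F.obj (X ⊗ Y))) (h : ∀ j, a j ≫ F.map (fst X Y) = b) :
    ∃ k : W ⟶ F.obj (X ⊗ ∏ᶜ fun _ : Fin n => Y), k ≫ F.map (fst _ _) = b ∧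
      ∀ j, k ≫ F.map (X ◁ Pi.π (fun _ : Fin n => Y) j) = a j := by
  refine ⟨CartesianMonoidalCategory.lift b (Pi.lift (fun j => a j ≫ F.map (snd X Y)) ≫
    inv (piComparison F fun _ : Fin n => Y)) ≫
      inv (CartesianMonoidalCategory.prodComparison F _ _), by simp, fun j => ?_⟩
  apply map_ext
  · rw [Category.assoc, ← F.map_comp, whiskerLeft_fst, h]
    simp
  · rw [Category.assoc, ← F.map_comp, whiskerLeft_snd, F.map_comp]
    simp

theorem map_tensor_pi_ext (F : C ⥤ C) [PreservesFiniteProducts F] {n : ℕ} {W X Y : C}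
    {f g : W ⟶ F.obj (X ⊗ ∏ᶜ fun _ : Fin n => Y)}
    (h1 : f ≫ F.map (fst _ _) = g ≫ F.map (fst _ _))
    (h2 : ∀ j, f ≫ F.map (X ◁ Pi.π (fun _ : Fin n => Y) j) =
      g ≫ F.map (X ◁ Pi.π (fun _ : Fin n => Y) j)) : f = g := by
  refine map_ext F h1 (map_pi_ext F fun j => ?_)
  have := congrArg (· ≫ F.map (snd X Y)) (h2 j)
  simp only [Category.assoc, ← F.map_comp, whiskerLeft_snd] at this
  simpa only [Category.assoc, F.map_comp] using this

theorem preservesPow_fst (F : C ⥤ C) [PreservesFiniteProducts F] (X Y : C) :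
    PreservesPow F (fst X Y) where
  preserves n := by
    refine preservesLimit_of_preserves_limit_cone (fstConeIsLimit X Y n) ?_
    choose k k1 k2 using fun t : Cone (powDiagram (fst X Y) n ⋙ F) =>
      exists_map_lift F (X := X) (Y := Y) (t.π.app none) (fun j : Fin n => t.π.app (some j))
        (fun j => t.w (WidePullbackShape.Hom.term j))
    refine ⟨k, ?_, ?_⟩
    · rintro t (_ | j)
      · exact k1 t
      · exact k2 t j
    · intro t m hm
      exact map_tensor_pi_ext F ((hm none).trans (k1 t).symm)
        fun j => (hm (some j)).trans (k2 t j).symm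

theorem preservesFiniteProducts_iter (F : C ⥤ C) [PreservesFiniteProducts F] (m : ℕ) :
    PreservesFiniteProducts (iter F m) := by
  induction m with
  | zero => exact inferInstanceAs (PreservesFiniteProducts (𝟭 C))
  | succ m ih => exact inferInstanceAs (PreservesFiniteProducts (iter F m ⋙ F))

section

variable (X M : C) [MonObj M]

/-- The sum `1 × • : X × (M × M) ⟶ X × M`, with `X × (M × M)` in the form of the pullback of two
copies of `X × M ⟶ X`. -/
def prodSum : (isBundle_fst X M).pow 2 ⟶ X ⊗ M :=
  CartesianMonoidalCategory.lift ((isBundle_fst X M).base 2)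
    (CartesianMonoidalCategory.lift ((isBundle_fst X M).ρ 2 0 ≫ snd X M)
      ((isBundle_fst X M).ρ 2 1 ≫ snd X M) ≫ μ[M])

variable {X M}

theorem prodSum_fst : prodSum X M ≫ fst X M = (isBundle_fst X M).base 2 := lift_fst _ _

theorem prodSum_snd : prodSum X M ≫ snd X M =
    CartesianMonoidalCategory.lift ((isBundle_fst X M).ρ 2 0 ≫ snd X M)
      ((isBundle_fst X M).ρ 2 1 ≫ snd X M) ≫ μ[M] := lift_snd _ _

theorem pair_prodSum {W : C} (a b : W ⟶ X ⊗ M) (h : a ≫ fst X M = b ≫ fst X M) :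
    (isBundle_fst X M).pair a b h ≫ prodSum X M =
      CartesianMonoidalCategory.lift (a ≫ fst X M)
        (CartesianMonoidalCategory.lift (a ≫ snd X M) (b ≫ snd X M) ≫ μ[M]) := by
  simp only [prodSum, comp_lift, comp_lift_assoc, ← IsBundle.ρ_comp _ 2 0]
  simp only [← Category.assoc, IsBundle.pair_ρ0, IsBundle.pair_ρ1]

end

/-- For a commutative monoid `M`, the projection `X × M ⟶ X` is an additive bundle with sum
`1 × •` and zero `⟨1, e⟩`. -/
def prodBundle [BraidedCategory C] (X M : C) [MonObj M] [IsCommMonObj M] :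
    AdditiveBundle (fst X M) where
  isBundle := isBundle_fst X M
  add := prodSum X M
  zero := CartesianMonoidalCategory.lift (𝟙 X) (toUnit X ≫ η[M])
  add_proj j := by rw [prodSum, lift_fst, IsBundle.ρ_comp]
  zero_proj := by simp
  add_assoc := by
    simp only [pair_prodSum, lift_fst, lift_snd, MonObj.lift_lift_assoc]
  zero_add := by
    rw [pair_prodSum]
    ext <;> simp
  add_zero := by
    rw [pair_prodSum]
    ext <;> simp
  add_comm := by
    rw [pair_prodSum, prodSum, IsBundle.ρ_comp]
    congr 1
    rw [← IsCommMonObj.mul_comm M, ← Category.assoc, lift_braiding_hom, IsCommMonObj.mul_comm]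

theorem prodBundle_isHom [BraidedCategory C] {X M X' M' : C} [MonObj M] [IsCommMonObj M]
    [MonObj M'] [IsCommMonObj M'] (f : X ⟶ X') (g : M ⟶ M') [IsMonHom g] :
    (prodBundle X M).IsHom (prodBundle X' M') (f ⊗ₘ g) f where
  w := tensorHom_fst _ _
  add := by
    change (isBundle_fst X' M').pair _ _ _ ≫ prodSum X' M' = prodSum X M ≫ (f ⊗ₘ g)
    rw [pair_prodSum]
    change CartesianMonoidalCategory.lift (((isBundle_fst X M).ρ 2 0 ≫ _) ≫ _)
      (CartesianMonoidalCategory.lift (((isBundle_fst X M).ρ 2 0 ≫ _) ≫ _)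
        (((isBundle_fst X M).ρ 2 1 ≫ _) ≫ _) ≫ _) = _
    simp only [prodSum, lift_map, Category.assoc, tensorHom_fst, tensorHom_snd,
      IsMonHom.mul_hom, lift_map_assoc]
    rw [← Category.assoc, IsBundle.ρ_comp]
  zero := by
    change CartesianMonoidalCategory.lift (𝟙 X) (toUnit X ≫ η[M]) ≫ (f ⊗ₘ g) =
      f ≫ CartesianMonoidalCategory.lift (𝟙 X') (toUnit X' ≫ η[M'])
    simp

end Products

section Assignments

variable (C : Type u) [Category.{v} C] [CartesianMonoidalCategory C] [BraidedCategory C]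

/-- A linear assignment `(L, +, 0, ν)` on a category with finite products. The operations
`+` and `0` on `L X` are the multiplication and the unit of the commutative monoid `L X`. -/
structure LinearAssignment where
  L : C ⥤ C
  preservesFiniteProducts : PreservesFiniteProducts L
  mon (X : C) : MonObj (L.obj X)
  comm (X : C) : IsCommMonObj (L.obj X)
  /-- naturality of `+` and `0` -/
  natural {X Y : C} (f : X ⟶ Y) : IsMonHom (L.map f)
  ν : L ⋙ L ≅ L
  ν_isMonHom (X : C) : IsMonHom (M := L.obj (L.obj X)) (N := L.obj X) (ν.hom.app X)
  ν_L (X : C) : ν.hom.app (L.obj X) = L.map (ν.hom.app X)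

attribute [instance] LinearAssignment.preservesFiniteProducts LinearAssignment.mon
  LinearAssignment.comm LinearAssignment.natural

/-- An additive assignment: a linear assignment with a natural negative which makes each
commutative monoid `L X` an abelian group. -/
structure AdditiveAssignment extends LinearAssignment C where
  neg : L ⟶ L
  add_neg (X : C) : CartesianMonoidalCategory.lift (𝟙 (L.obj X)) (neg.app X) ≫ μ[L.obj X] =
    toUnit (L.obj X) ≫ η[L.obj X]
  neg_add (X : C) : CartesianMonoidalCategory.lift (neg.app X) (𝟙 (L.obj X)) ≫ μ[L.obj X] =
    toUnit (L.obj X) ≫ η[L.obj X]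

variable {C}

namespace LinearAssignment

variable (𝓛 : LinearAssignment C)

/-- An `L`-algebra: an object `A` with an isomorphism `a : L A ≅ A` such that `L(a) = ν_A`. -/
structure Algebra where
  A : C
  a : 𝓛.L.obj A ≅ A
  map_a : 𝓛.L.map a.hom = 𝓛.ν.hom.app A

namespace Algebra

variable {𝓛}

/-- Morphisms of `L`-algebras. -/
@[ext]
structure Hom (A B : 𝓛.Algebra) where
  hom : A.A ⟶ B.A
  comm : 𝓛.L.map hom ≫ B.a.hom = A.a.hom ≫ hom

/-- The category of `L`-algebras. -/
instance : Category.{v} 𝓛.Algebra where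
  Hom := Hom
  id A := ⟨𝟙 _, by simp⟩
  comp f g := ⟨f.hom ≫ g.hom, by
    rw [Functor.map_comp, Category.assoc, g.comm, ← Category.assoc, f.comm, Category.assoc]⟩
  id_comp f := Hom.ext (Category.id_comp _)
  comp_id f := Hom.ext (Category.comp_id _)
  assoc f g h := Hom.ext (Category.assoc _ _ _)

end Algebra

/-- The tangent bundle functor `T X = X × L X`. -/
@[simps]
def tangentFunctor : C ⥤ C where
  obj X := X ⊗ 𝓛.L.obj X
  map f := f ⊗ₘ 𝓛.L.map f

instance : PreservesFiniteProducts 𝓛.tangentFunctor := by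
  have h1 : IsIso (CartesianMonoidalCategory.terminalComparison 𝓛.tangentFunctor) := by
    refine ⟨⟨CartesianMonoidalCategory.lift (𝟙 _) (inv (CartesianMonoidalCategory.terminalComparison 𝓛.L)),
      ?_, toUnit_unique _ _⟩⟩
    apply CartesianMonoidalCategory.hom_ext
    · exact toUnit_unique _ _
    · rw [← cancel_mono (CartesianMonoidalCategory.terminalComparison 𝓛.L)]
      exact toUnit_unique _ _
  have h2 : ∀ A B, IsIso (CartesianMonoidalCategory.prodComparison 𝓛.tangentFunctor A B) := by
    intro A B
    let f : (A ⊗ B) ⊗ 𝓛.L.obj (A ⊗ B) ⟶ (A ⊗ 𝓛.L.obj A) ⊗ (B ⊗ 𝓛.L.obj B) :=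
      CartesianMonoidalCategory.lift (fst A B ⊗ₘ 𝓛.L.map (fst A B))
        (snd A B ⊗ₘ 𝓛.L.map (snd A B))
    let g : (A ⊗ 𝓛.L.obj A) ⊗ (B ⊗ 𝓛.L.obj B) ⟶ (A ⊗ B) ⊗ 𝓛.L.obj (A ⊗ B) :=
      CartesianMonoidalCategory.lift (fst A (𝓛.L.obj A) ⊗ₘ fst B (𝓛.L.obj B))
        ((snd A (𝓛.L.obj A) ⊗ₘ snd B (𝓛.L.obj B)) ≫
          inv (CartesianMonoidalCategory.prodComparison 𝓛.L A B))
    have hfg : f ≫ g = 𝟙 _ := by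
      apply CartesianMonoidalCategory.hom_ext
      · ext <;> simp [f, g]
      · apply map_ext <;> simp [f, g]
    have hgf : g ≫ f = 𝟙 _ := by
      ext <;> simp [f, g]
    exact ⟨⟨g, hfg, hgf⟩⟩
  have := preservesLimit_empty_of_isIso_terminalComparison 𝓛.tangentFunctor
  have := preservesLimitsOfShape_discrete_walkingPair_of_isIso_prodComparison 𝓛.tangentFunctor
  have := preservesLimitsOfShape_pempty_of_preservesTerminal 𝓛.tangentFunctor
  exact .of_preserves_binary_and_terminal _

theorem hom_unit_ext {W : C} (f g : W ⟶ 𝓛.L.obj (𝟙_ C)) : f = g := by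
  rw [← cancel_mono (CartesianMonoidalCategory.terminalComparison 𝓛.L)]
  exact toUnit_unique _ _

theorem zero_map {X Y : C} (f : X ⟶ Y) : η[𝓛.L.obj X] ≫ 𝓛.L.map f = η[𝓛.L.obj Y] :=
  IsMonHom.one_hom _

theorem sum_map {W X Y : C} (a b : W ⟶ 𝓛.L.obj X) (f : X ⟶ Y) :
    CartesianMonoidalCategory.lift a b ≫ μ[𝓛.L.obj X] ≫ 𝓛.L.map f =
      CartesianMonoidalCategory.lift (a ≫ 𝓛.L.map f) (b ≫ 𝓛.L.map f) ≫ μ[𝓛.L.obj Y] := by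
  rw [IsMonHom.mul_hom, lift_map_assoc]

theorem map_zero (W X : C) : 𝓛.L.map (toUnit W ≫ η[𝓛.L.obj X]) =
    toUnit (𝓛.L.obj W) ≫ η[𝓛.L.obj (𝓛.L.obj X)] := by
  rw [← 𝓛.zero_map η[𝓛.L.obj X], Functor.map_comp, ← Category.assoc]
  congr 1
  exact 𝓛.hom_unit_ext _ _

/-- The sum of `L (L X)` agrees with the image under `L` of the sum of `L X`. -/
theorem map_sum {W X : C} (a b : W ⟶ 𝓛.L.obj X) :
    𝓛.L.map (CartesianMonoidalCategory.lift a b ≫ μ[𝓛.L.obj X]) =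
      CartesianMonoidalCategory.lift (𝓛.L.map a) (𝓛.L.map b) ≫ μ[𝓛.L.obj (𝓛.L.obj X)] := by
  let M := 𝓛.L.obj X
  have hl : ∀ {V : C} (f g : V ⟶ 𝓛.L.obj M) (k : V ⟶ 𝓛.L.obj (M ⊗ M)),
      k ≫ 𝓛.L.map (fst M M) = f → k ≫ 𝓛.L.map (snd M M) = g →
      k ≫ 𝓛.L.map μ[M] = f * g := by
    intro V f g k hf hg
    let k₁ : V ⟶ 𝓛.L.obj (M ⊗ M) :=
      f ≫ 𝓛.L.map (CartesianMonoidalCategory.lift (𝟙 M) (toUnit M ≫ η[M]))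
    let k₂ : V ⟶ 𝓛.L.obj (M ⊗ M) :=
      g ≫ 𝓛.L.map (CartesianMonoidalCategory.lift (toUnit M ≫ η[M]) (𝟙 M))
    have e1 : k₁ ≫ 𝓛.L.map μ[M] = f := by
      simp only [k₁, Category.assoc, ← Functor.map_comp]
      simp
    have e2 : k₂ ≫ 𝓛.L.map μ[M] = g := by
      simp only [k₂, Category.assoc, ← Functor.map_comp]
      simp
    have e3 : k = k₁ * k₂ := by
      rw [Hom.mul_def]
      apply map_ext
      · rw [Category.assoc, sum_map]
        simp only [k₁, k₂, Category.assoc, ← Functor.map_comp, lift_fst]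
        rw [map_zero, hf]
        simp
      · rw [Category.assoc, sum_map]
        simp only [k₁, k₂, Category.assoc, ← Functor.map_comp, lift_snd]
        rw [map_zero, hg]
        simp
    rw [e3, Hom.mul_def, Category.assoc, sum_map, e1, e2, Hom.mul_def]
  rw [Functor.map_comp]
  refine hl _ _ _ ?_ ?_
  · rw [← Functor.map_comp, CartesianMonoidalCategory.lift_fst]
  · rw [← Functor.map_comp, CartesianMonoidalCategory.lift_snd]

/-- The additive bundle `(p, s, z)` over `X` with `p = π₁ : X × L X ⟶ X`, `s = 1 × +` and
`z = ⟨1, 0⟩`. -/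
def tangentBun (X : C) : AdditiveBundle (fst X (𝓛.L.obj X)) :=
  prodBundle X (𝓛.L.obj X)

theorem tangentPreservesPow (X : C) (m : ℕ) :
    PreservesPow (iter 𝓛.tangentFunctor m) (fst X (𝓛.L.obj X)) :=
  haveI := preservesFiniteProducts_iter 𝓛.tangentFunctor m
  preservesPow_fst _ _ _

/-- The vertical lift of `T X = X × L X`. -/
def tangentLift (X : C) : X ⊗ 𝓛.L.obj X ⟶ (X ⊗ 𝓛.L.obj X) ⊗ 𝓛.L.obj (X ⊗ 𝓛.L.obj X) :=
  (CartesianMonoidalCategory.lift (𝟙 X) (toUnit X ≫ η[𝓛.L.obj X]) ⊗ₘ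
    CartesianMonoidalCategory.lift (toUnit (𝓛.L.obj X) ≫ η[𝓛.L.obj X]) (𝓛.ν.inv.app X)) ≫
  (𝟙 (X ⊗ 𝓛.L.obj X) ⊗ₘ inv (CartesianMonoidalCategory.prodComparison 𝓛.L X (𝓛.L.obj X)))

/-- The canonical flip of `T X = X × L X`. -/
def tangentFlip (X : C) : (X ⊗ 𝓛.L.obj X) ⊗ 𝓛.L.obj (X ⊗ 𝓛.L.obj X) ⟶
    (X ⊗ 𝓛.L.obj X) ⊗ 𝓛.L.obj (X ⊗ 𝓛.L.obj X) :=
  (𝟙 (X ⊗ 𝓛.L.obj X) ⊗ₘ CartesianMonoidalCategory.prodComparison 𝓛.L X (𝓛.L.obj X)) ≫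
  tensorμ X (𝓛.L.obj X) (𝓛.L.obj X) (𝓛.L.obj (𝓛.L.obj X)) ≫
  (𝟙 (X ⊗ 𝓛.L.obj X) ⊗ₘ inv (CartesianMonoidalCategory.prodComparison 𝓛.L X (𝓛.L.obj X)))

theorem tangentLift_fst (X : C) : 𝓛.tangentLift X ≫ fst _ _ =
    fst _ _ ≫ CartesianMonoidalCategory.lift (𝟙 X) (toUnit X ≫ η[𝓛.L.obj X]) := by
  simp only [tangentLift, Category.assoc, tensorHom_fst, Category.comp_id]

theorem tangentLift_snd_fst (X : C) : 𝓛.tangentLift X ≫ snd _ _ ≫ 𝓛.L.map (fst _ _) =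
    toUnit _ ≫ η[𝓛.L.obj X] := by
  simp [tangentLift]

theorem tangentLift_snd_snd (X : C) : 𝓛.tangentLift X ≫ snd _ _ ≫ 𝓛.L.map (snd _ _) =
    snd _ _ ≫ 𝓛.ν.inv.app X := by
  simp [tangentLift]

theorem tangentFlip_fst (X : C) : 𝓛.tangentFlip X ≫ fst _ _ =
    CartesianMonoidalCategory.lift (fst _ _ ≫ fst _ _) (snd _ _ ≫ 𝓛.L.map (fst _ _)) := by
  simp only [tangentFlip, Category.assoc]
  ext <;> simp

theorem tangentFlip_snd_fst (X : C) : 𝓛.tangentFlip X ≫ snd _ _ ≫ 𝓛.L.map (fst _ _) =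
    fst _ _ ≫ snd _ _ := by
  simp [tangentFlip]

theorem tangentFlip_snd_snd (X : C) : 𝓛.tangentFlip X ≫ snd _ _ ≫ 𝓛.L.map (snd _ _) =
    snd _ _ ≫ 𝓛.L.map (snd _ _) := by
  simp [tangentFlip]

/-- Extensionality for morphisms into `T (T X)`. -/
theorem tangent_ext {W X : C} {f g : W ⟶ (X ⊗ 𝓛.L.obj X) ⊗ 𝓛.L.obj (X ⊗ 𝓛.L.obj X)}
    (h1 : f ≫ fst _ _ = g ≫ fst _ _)
    (h2 : f ≫ snd _ _ ≫ 𝓛.L.map (fst _ _) = g ≫ snd _ _ ≫ 𝓛.L.map (fst _ _))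
    (h3 : f ≫ snd _ _ ≫ 𝓛.L.map (snd _ _) = g ≫ snd _ _ ≫ 𝓛.L.map (snd _ _)) : f = g :=
  CartesianMonoidalCategory.hom_ext _ _ h1
    (map_ext 𝓛.L (by simpa using h2) (by simpa using h3))

theorem tangentLift_naturality {X Y : C} (f : X ⟶ Y) :
    (f ⊗ₘ 𝓛.L.map f) ≫ 𝓛.tangentLift Y =
      𝓛.tangentLift X ≫ ((f ⊗ₘ 𝓛.L.map f) ⊗ₘ 𝓛.L.map (f ⊗ₘ 𝓛.L.map f)) := by
  have hν := 𝓛.ν.inv.naturality f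
  apply 𝓛.tangent_ext
  · simp only [Category.assoc, tangentLift_fst, tensorHom_fst, reassoc_of% 𝓛.tangentLift_fst,
      reassoc_of% tensorHom_fst f (𝓛.L.map f)]
    congr 1
    ext <;> simp
  · simp only [Category.assoc, tangentLift_snd_fst, tensorHom_snd_assoc, ← Functor.map_comp,
      tensorHom_fst]
    simp only [Functor.map_comp, reassoc_of% 𝓛.tangentLift_snd_fst, zero_map, comp_toUnit_assoc]
  · simp only [Category.assoc, tangentLift_snd_snd, tensorHom_snd_assoc, ← Functor.map_comp,
      tensorHom_snd]
    simp only [Functor.map_comp, reassoc_of% 𝓛.tangentLift_snd_snd]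
    exact congrArg (snd X (𝓛.L.obj X) ≫ ·) hν

theorem tangentFlip_naturality {X Y : C} (f : X ⟶ Y) :
    ((f ⊗ₘ 𝓛.L.map f) ⊗ₘ 𝓛.L.map (f ⊗ₘ 𝓛.L.map f)) ≫ 𝓛.tangentFlip Y =
      𝓛.tangentFlip X ≫ ((f ⊗ₘ 𝓛.L.map f) ⊗ₘ 𝓛.L.map (f ⊗ₘ 𝓛.L.map f)) := by
  apply 𝓛.tangent_ext
  · simp only [Category.assoc, tangentFlip_fst, tensorHom_fst, reassoc_of% 𝓛.tangentFlip_fst,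
      comp_lift, lift_map, tensorHom_fst_assoc, tensorHom_snd_assoc, ← Functor.map_comp]
  · simp only [Category.assoc, tangentFlip_snd_fst, tensorHom_snd_assoc, tensorHom_fst_assoc,
      tensorHom_snd, ← Functor.map_comp, tensorHom_fst]
    simp only [Functor.map_comp, reassoc_of% 𝓛.tangentFlip_snd_fst]
  · simp only [Category.assoc, tangentFlip_snd_snd, tensorHom_snd_assoc, ← Functor.map_comp,
      tensorHom_snd]
    simp only [Functor.map_comp, reassoc_of% 𝓛.tangentFlip_snd_snd]

theorem tangentFlip_flip (X : C) : 𝓛.tangentFlip X ≫ 𝓛.tangentFlip X = 𝟙 _ := by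
  apply 𝓛.tangent_ext
  · simp only [Category.assoc, tangentFlip_fst, comp_lift, reassoc_of% 𝓛.tangentFlip_fst,
      tangentFlip_snd_fst, lift_fst, Category.id_comp]
    ext <;> simp
  · simp only [Category.assoc, tangentFlip_snd_fst, reassoc_of% 𝓛.tangentFlip_fst, lift_snd,
      Category.id_comp]
  · simp only [Category.assoc, tangentFlip_snd_snd, Category.id_comp]

theorem tangentLift_flip (X : C) :
    𝓛.tangentLift X ≫ 𝓛.tangentFlip X = 𝓛.tangentLift X := by
  apply 𝓛.tangent_ext
  · simp only [Category.assoc, tangentFlip_fst, comp_lift, reassoc_of% 𝓛.tangentLift_fst,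
      tangentLift_snd_fst, tangentLift_fst, lift_fst, Category.comp_id, comp_toUnit_assoc]
  · simp only [Category.assoc, tangentFlip_snd_fst, reassoc_of% 𝓛.tangentLift_fst, lift_snd,
      tangentLift_snd_fst, comp_toUnit_assoc]
  · simp only [Category.assoc, tangentFlip_snd_snd]

theorem ν_inv_L (X : C) : 𝓛.ν.inv.app (𝓛.L.obj X) = 𝓛.L.map (𝓛.ν.inv.app X) := by
  have h : 𝓛.ν.hom.app (𝓛.L.obj X) ≫ 𝓛.L.map (𝓛.ν.inv.app X) = 𝟙 _ := by
    rw [𝓛.ν_L, ← Functor.map_comp, Iso.hom_inv_id_app]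
    exact 𝓛.L.map_id _
  have h' : 𝓛.ν.inv.app (𝓛.L.obj X) ≫ 𝓛.ν.hom.app (𝓛.L.obj X) = 𝟙 _ := Iso.inv_hom_id_app _ _
  calc _ = 𝓛.ν.inv.app (𝓛.L.obj X) ≫ 𝓛.ν.hom.app (𝓛.L.obj X) ≫ 𝓛.L.map (𝓛.ν.inv.app X) := by
        rw [h]; exact (Category.comp_id _).symm
    _ = _ := by rw [← Category.assoc, h']; exact Category.id_comp _

theorem ν_inv_map {X Y : C} (f : X ⟶ Y) :
    𝓛.ν.inv.app X ≫ 𝓛.L.map (𝓛.L.map f) = 𝓛.L.map f ≫ 𝓛.ν.inv.app Y :=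
  (𝓛.ν.inv.naturality f).symm

theorem zero_ν_inv (X : C) : η[𝓛.L.obj X] ≫ 𝓛.ν.inv.app X = η[𝓛.L.obj (𝓛.L.obj X)] := by
  have h := (𝓛.ν_isMonHom X).one_hom
  have h' : 𝓛.ν.hom.app X ≫ 𝓛.ν.inv.app X = 𝟙 (𝓛.L.obj (𝓛.L.obj X)) := Iso.hom_inv_id_app _ _
  rw [← h, Category.assoc]
  exact (congrArg _ h').trans (Category.comp_id _)

theorem sum_ν_inv {W X : C} (a b : W ⟶ 𝓛.L.obj X) :
    CartesianMonoidalCategory.lift a b ≫ μ[𝓛.L.obj X] ≫ 𝓛.ν.inv.app X =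
      CartesianMonoidalCategory.lift (a ≫ 𝓛.ν.inv.app X) (b ≫ 𝓛.ν.inv.app X) ≫
        μ[𝓛.L.obj (𝓛.L.obj X)] := by
  have h := (𝓛.ν_isMonHom X).mul_hom
  have h1 : 𝓛.ν.hom.app X ≫ 𝓛.ν.inv.app X = 𝟙 (𝓛.L.obj (𝓛.L.obj X)) := Iso.hom_inv_id_app _ _
  have h2 : 𝓛.ν.inv.app X ≫ 𝓛.ν.hom.app X = 𝟙 (𝓛.L.obj X) := Iso.inv_hom_id_app _ _
  have ha : ∀ c : W ⟶ 𝓛.L.obj X, (c ≫ 𝓛.ν.inv.app X) ≫ 𝓛.ν.hom.app X = c := fun c => by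
    rw [Category.assoc]
    exact (congrArg (c ≫ ·) h2).trans (Category.comp_id _)
  have h3 : CartesianMonoidalCategory.lift a b ≫ μ[𝓛.L.obj X] =
      (CartesianMonoidalCategory.lift (a ≫ 𝓛.ν.inv.app X) (b ≫ 𝓛.ν.inv.app X) ≫
        μ[𝓛.L.obj (𝓛.L.obj X)]) ≫ 𝓛.ν.hom.app X := by
    refine Eq.trans ?_ (Category.assoc _ _ _).symm
    refine Eq.trans ?_ (congrArg (CartesianMonoidalCategory.lift (a ≫ 𝓛.ν.inv.app X)
      (b ≫ 𝓛.ν.inv.app X) ≫ ·) h).symm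
    refine Eq.trans ?_ (lift_map_assoc _ _ _ _ _).symm
    rw [ha a, ha b]
  rw [← Category.assoc, h3, Category.assoc]
  exact (congrArg (_ ≫ ·) h1).trans (Category.comp_id _)

/-- Extensionality for morphisms into `T (T (T X))`, in terms of its eight components. -/
theorem tangent_ext8 {W X : C} {f g : W ⟶ ((X ⊗ 𝓛.L.obj X) ⊗ 𝓛.L.obj (X ⊗ 𝓛.L.obj X)) ⊗
      𝓛.L.obj ((X ⊗ 𝓛.L.obj X) ⊗ 𝓛.L.obj (X ⊗ 𝓛.L.obj X))}
    (h1 : f ≫ fst _ _ ≫ fst _ _ ≫ fst _ _ = g ≫ fst _ _ ≫ fst _ _ ≫ fst _ _)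
    (h2 : f ≫ fst _ _ ≫ fst _ _ ≫ snd _ _ = g ≫ fst _ _ ≫ fst _ _ ≫ snd _ _)
    (h3 : f ≫ fst _ _ ≫ snd _ _ ≫ 𝓛.L.map (fst _ _) =
      g ≫ fst _ _ ≫ snd _ _ ≫ 𝓛.L.map (fst _ _))
    (h4 : f ≫ fst _ _ ≫ snd _ _ ≫ 𝓛.L.map (snd _ _) =
      g ≫ fst _ _ ≫ snd _ _ ≫ 𝓛.L.map (snd _ _))
    (h5 : f ≫ snd _ _ ≫ 𝓛.L.map (fst _ _) ≫ 𝓛.L.map (fst _ _) =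
      g ≫ snd _ _ ≫ 𝓛.L.map (fst _ _) ≫ 𝓛.L.map (fst _ _))
    (h6 : f ≫ snd _ _ ≫ 𝓛.L.map (fst _ _) ≫ 𝓛.L.map (snd _ _) =
      g ≫ snd _ _ ≫ 𝓛.L.map (fst _ _) ≫ 𝓛.L.map (snd _ _))
    (h7 : f ≫ snd _ _ ≫ 𝓛.L.map (snd _ _) ≫ 𝓛.L.map (𝓛.L.map (fst _ _)) =
      g ≫ snd _ _ ≫ 𝓛.L.map (snd _ _) ≫ 𝓛.L.map (𝓛.L.map (fst _ _)))
    (h8 : f ≫ snd _ _ ≫ 𝓛.L.map (snd _ _) ≫ 𝓛.L.map (𝓛.L.map (snd _ _)) =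
      g ≫ snd _ _ ≫ 𝓛.L.map (snd _ _) ≫ 𝓛.L.map (𝓛.L.map (snd _ _))) : f = g := by
  apply 𝓛.tangent_ext
  · apply 𝓛.tangent_ext
    · ext <;> simpa
    · simpa using h3
    · simpa using h4
  · apply map_ext <;> simpa
  · exact map_ext (𝓛.L ⋙ 𝓛.L) (by simpa using h7) (by simpa using h8)

theorem lift_c1 (X : C) : 𝓛.tangentLift X ≫ fst _ _ ≫ fst _ _ = fst _ _ := by
  rw [reassoc_of% 𝓛.tangentLift_fst, lift_fst, Category.comp_id]

theorem lift_c2 (X : C) :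
    𝓛.tangentLift X ≫ fst _ _ ≫ snd _ _ = toUnit _ ≫ η[𝓛.L.obj X] := by
  rw [reassoc_of% 𝓛.tangentLift_fst, lift_snd, comp_toUnit_assoc]

theorem lift_d1 (X : C) : 𝓛.L.map (𝓛.tangentLift X) ≫ 𝓛.L.map (fst _ _) ≫
    𝓛.L.map (fst _ _) = 𝓛.L.map (fst _ _) := by
  simp only [← Functor.map_comp, lift_c1]

theorem lift_d2 (X : C) : 𝓛.L.map (𝓛.tangentLift X) ≫ 𝓛.L.map (fst _ _) ≫
    𝓛.L.map (snd _ _) = toUnit _ ≫ η[𝓛.L.obj (𝓛.L.obj X)] := by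
  simp only [← Functor.map_comp, lift_c2, map_zero]

theorem lift_d3 (X : C) : 𝓛.L.map (𝓛.tangentLift X) ≫ 𝓛.L.map (snd _ _) ≫
    𝓛.L.map (𝓛.L.map (fst _ _)) = toUnit _ ≫ η[𝓛.L.obj (𝓛.L.obj X)] := by
  simp only [← Functor.map_comp, tangentLift_snd_fst, map_zero]

theorem lift_d4 (X : C) : 𝓛.L.map (𝓛.tangentLift X) ≫ 𝓛.L.map (snd _ _) ≫
    𝓛.L.map (𝓛.L.map (snd _ _)) = 𝓛.L.map (snd _ _) ≫ 𝓛.L.map (𝓛.ν.inv.app X) := by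
  simp only [← Functor.map_comp, tangentLift_snd_snd]

theorem flip_c1 (X : C) : 𝓛.tangentFlip X ≫ fst _ _ ≫ fst _ _ = fst _ _ ≫ fst _ _ := by
  rw [reassoc_of% 𝓛.tangentFlip_fst, lift_fst]

theorem flip_c2 (X : C) :
    𝓛.tangentFlip X ≫ fst _ _ ≫ snd _ _ = snd _ _ ≫ 𝓛.L.map (fst _ _) := by
  rw [reassoc_of% 𝓛.tangentFlip_fst, lift_snd]

theorem flip_d1 (X : C) : 𝓛.L.map (𝓛.tangentFlip X) ≫ 𝓛.L.map (fst _ _) ≫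
    𝓛.L.map (fst _ _) = 𝓛.L.map (fst _ _) ≫ 𝓛.L.map (fst _ _) := by
  simp only [← Functor.map_comp, flip_c1]

theorem flip_d2 (X : C) : 𝓛.L.map (𝓛.tangentFlip X) ≫ 𝓛.L.map (fst _ _) ≫
    𝓛.L.map (snd _ _) = 𝓛.L.map (snd _ _) ≫ 𝓛.L.map (𝓛.L.map (fst _ _)) := by
  simp only [← Functor.map_comp, flip_c2]

theorem flip_d3 (X : C) : 𝓛.L.map (𝓛.tangentFlip X) ≫ 𝓛.L.map (snd _ _) ≫
    𝓛.L.map (𝓛.L.map (fst _ _)) = 𝓛.L.map (fst _ _) ≫ 𝓛.L.map (snd _ _) := by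
  simp only [← Functor.map_comp, tangentFlip_snd_fst]

theorem flip_d4 (X : C) : 𝓛.L.map (𝓛.tangentFlip X) ≫ 𝓛.L.map (snd _ _) ≫
    𝓛.L.map (𝓛.L.map (snd _ _)) = 𝓛.L.map (snd _ _) ≫ 𝓛.L.map (𝓛.L.map (snd _ _)) := by
  simp only [← Functor.map_comp, tangentFlip_snd_snd]

theorem tangent_lift_lift (X : C) :
    𝓛.tangentLift X ≫ 𝓛.tangentLift (X ⊗ 𝓛.L.obj X) =
      𝓛.tangentLift X ≫ (𝓛.tangentLift X ⊗ₘ 𝓛.L.map (𝓛.tangentLift X)) := by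
  apply 𝓛.tangent_ext8 <;>
  simp only [Category.assoc, tensorHom_fst_assoc, tensorHom_snd_assoc,
    lift_c1, reassoc_of% 𝓛.lift_c1, lift_c2, reassoc_of% 𝓛.lift_c2,
    tangentLift_snd_fst, reassoc_of% 𝓛.tangentLift_snd_fst,
    tangentLift_snd_snd, reassoc_of% 𝓛.tangentLift_snd_snd,
    lift_d1, lift_d2, lift_d3, lift_d4, comp_toUnit_assoc,
    zero_map, ν_inv_map, ν_inv_L, zero_ν_inv]

theorem tangent_lift_flip_flip (X : C) :
    𝓛.tangentLift (X ⊗ 𝓛.L.obj X) ≫ (𝓛.tangentFlip X ⊗ₘ 𝓛.L.map (𝓛.tangentFlip X)) ≫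
      𝓛.tangentFlip (X ⊗ 𝓛.L.obj X) =
    𝓛.tangentFlip X ≫ (𝓛.tangentLift X ⊗ₘ 𝓛.L.map (𝓛.tangentLift X)) := by
  apply 𝓛.tangent_ext8 <;>
  simp only [Category.assoc, tensorHom_fst_assoc, tensorHom_snd_assoc,
    lift_c1, reassoc_of% 𝓛.lift_c1, lift_c2, reassoc_of% 𝓛.lift_c2,
    tangentLift_snd_fst, reassoc_of% 𝓛.tangentLift_snd_fst,
    tangentLift_snd_snd, reassoc_of% 𝓛.tangentLift_snd_snd,
    lift_d1, lift_d2, lift_d3, lift_d4, comp_toUnit_assoc,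
    zero_map, ν_inv_map, ν_inv_L,
    flip_c1, reassoc_of% 𝓛.flip_c1, flip_c2, reassoc_of% 𝓛.flip_c2,
    tangentFlip_snd_fst, reassoc_of% 𝓛.tangentFlip_snd_fst,
    tangentFlip_snd_snd, reassoc_of% 𝓛.tangentFlip_snd_snd,
    flip_d1, flip_d2, flip_d3, flip_d4]

theorem tangent_yang_baxter (X : C) :
    (𝓛.tangentFlip X ⊗ₘ 𝓛.L.map (𝓛.tangentFlip X)) ≫ 𝓛.tangentFlip (X ⊗ 𝓛.L.obj X) ≫
      (𝓛.tangentFlip X ⊗ₘ 𝓛.L.map (𝓛.tangentFlip X)) =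
    𝓛.tangentFlip (X ⊗ 𝓛.L.obj X) ≫ (𝓛.tangentFlip X ⊗ₘ 𝓛.L.map (𝓛.tangentFlip X)) ≫
      𝓛.tangentFlip (X ⊗ 𝓛.L.obj X) := by
  apply 𝓛.tangent_ext8 <;>
  simp only [Category.assoc, tensorHom_fst_assoc, tensorHom_snd_assoc,
    flip_c1, reassoc_of% 𝓛.flip_c1, flip_c2, reassoc_of% 𝓛.flip_c2,
    tangentFlip_snd_fst, reassoc_of% 𝓛.tangentFlip_snd_fst,
    tangentFlip_snd_snd, reassoc_of% 𝓛.tangentFlip_snd_snd,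
    flip_d1, flip_d2, flip_d3, flip_d4]

section

variable {W X : C} {k : W ⟶ (isBundle_fst X (𝓛.L.obj X)).pow 2 ⊗
    𝓛.L.obj ((isBundle_fst X (𝓛.L.obj X)).pow 2)}
  {a b : W ⟶ (X ⊗ 𝓛.L.obj X) ⊗ 𝓛.L.obj (X ⊗ 𝓛.L.obj X)}

theorem tangent_sum_fst (ha : k ≫ ((isBundle_fst X (𝓛.L.obj X)).ρ 2 0 ⊗ₘ
      𝓛.L.map ((isBundle_fst X (𝓛.L.obj X)).ρ 2 0)) = a)
    (hb : k ≫ ((isBundle_fst X (𝓛.L.obj X)).ρ 2 1 ⊗ₘ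
      𝓛.L.map ((isBundle_fst X (𝓛.L.obj X)).ρ 2 1)) = b) :
    (k ≫ (prodSum X (𝓛.L.obj X) ⊗ₘ 𝓛.L.map (prodSum X (𝓛.L.obj X)))) ≫ fst _ _ =
      CartesianMonoidalCategory.lift (a ≫ fst _ _ ≫ fst _ _)
        (CartesianMonoidalCategory.lift (a ≫ fst _ _ ≫ snd _ _) (b ≫ fst _ _ ≫ snd _ _) ≫
          μ[𝓛.L.obj X]) := by
  subst ha hb
  simp only [Category.assoc, tensorHom_fst, tensorHom_fst_assoc, prodSum, comp_lift,
    comp_lift_assoc, IsBundle.ρ_comp]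

theorem tangent_sum_snd_fst (ha : k ≫ ((isBundle_fst X (𝓛.L.obj X)).ρ 2 0 ⊗ₘ
      𝓛.L.map ((isBundle_fst X (𝓛.L.obj X)).ρ 2 0)) = a) :
    (k ≫ (prodSum X (𝓛.L.obj X) ⊗ₘ 𝓛.L.map (prodSum X (𝓛.L.obj X)))) ≫ snd _ _ ≫
      𝓛.L.map (fst _ _) = a ≫ snd _ _ ≫ 𝓛.L.map (fst _ _) := by
  subst ha
  simp only [Category.assoc, tensorHom_snd_assoc, ← Functor.map_comp, prodSum,
    CartesianMonoidalCategory.lift_fst, IsBundle.ρ_comp]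

theorem tangent_sum_snd_snd (ha : k ≫ ((isBundle_fst X (𝓛.L.obj X)).ρ 2 0 ⊗ₘ
      𝓛.L.map ((isBundle_fst X (𝓛.L.obj X)).ρ 2 0)) = a)
    (hb : k ≫ ((isBundle_fst X (𝓛.L.obj X)).ρ 2 1 ⊗ₘ
      𝓛.L.map ((isBundle_fst X (𝓛.L.obj X)).ρ 2 1)) = b) :
    (k ≫ (prodSum X (𝓛.L.obj X) ⊗ₘ 𝓛.L.map (prodSum X (𝓛.L.obj X)))) ≫ snd _ _ ≫
      𝓛.L.map (snd _ _) =
      CartesianMonoidalCategory.lift (a ≫ snd _ _ ≫ 𝓛.L.map (snd _ _))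
        (b ≫ snd _ _ ≫ 𝓛.L.map (snd _ _)) ≫ μ[𝓛.L.obj (𝓛.L.obj X)] := by
  subst ha hb
  simp only [Category.assoc, tensorHom_snd_assoc, ← Functor.map_comp, prodSum,
    CartesianMonoidalCategory.lift_snd, map_sum, comp_lift_assoc]

end

theorem tangent_add_eq {W X : C} (hP : PreservesPow 𝓛.tangentFunctor (fst X (𝓛.L.obj X)))
    (hq : IsBundle (fst X (𝓛.L.obj X)))
    {a b r : W ⟶ (X ⊗ 𝓛.L.obj X) ⊗ 𝓛.L.obj (X ⊗ 𝓛.L.obj X)}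
    (h : a ≫ 𝓛.tangentFunctor.map (fst X (𝓛.L.obj X)) =
      b ≫ 𝓛.tangentFunctor.map (fst X (𝓛.L.obj X)))
    (h1 : r ≫ fst _ _ = CartesianMonoidalCategory.lift (a ≫ fst _ _ ≫ fst _ _)
        (CartesianMonoidalCategory.lift (a ≫ fst _ _ ≫ snd _ _) (b ≫ fst _ _ ≫ snd _ _) ≫
          μ[𝓛.L.obj X]))
    (h2 : r ≫ snd _ _ ≫ 𝓛.L.map (fst _ _) = a ≫ snd _ _ ≫ 𝓛.L.map (fst _ _))
    (h3 : r ≫ snd _ _ ≫ 𝓛.L.map (snd _ _) =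
      CartesianMonoidalCategory.lift (a ≫ snd _ _ ≫ 𝓛.L.map (snd _ _))
        (b ≫ snd _ _ ≫ 𝓛.L.map (snd _ _)) ≫ μ[𝓛.L.obj (𝓛.L.obj X)]) :
    hP.pair hq a b h ≫ 𝓛.tangentFunctor.map (prodSum X (𝓛.L.obj X)) = r := by
  have ha := hP.pair_ρ0 hq a b h
  have hb := hP.pair_ρ1 hq a b h
  refine 𝓛.tangent_ext ?_ ?_ ?_
  · exact (𝓛.tangent_sum_fst ha hb).trans h1.symm
  · exact (𝓛.tangent_sum_snd_fst ha).trans h2.symm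
  · exact (𝓛.tangent_sum_snd_snd ha hb).trans h3.symm

theorem tangentPreservesPow_one (X : C) :
    PreservesPow 𝓛.tangentFunctor (fst X (𝓛.L.obj X)) :=
  .of_iter (𝓛.tangentPreservesPow X)

theorem tangentLift_isHom (X : C) : (𝓛.tangentBun X).IsHom
    ((𝓛.tangentBun X).map 𝓛.tangentFunctor (𝓛.tangentPreservesPow_one X))
    (𝓛.tangentLift X) (𝓛.tangentBun X).zero where
  w := by
    change 𝓛.tangentLift X ≫ (fst _ _ ⊗ₘ 𝓛.L.map (fst _ _)) =
      fst _ _ ≫ CartesianMonoidalCategory.lift (𝟙 X) (toUnit X ≫ η[𝓛.L.obj X])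
    apply CartesianMonoidalCategory.hom_ext
    · simp only [Category.assoc, tensorHom_fst, lift_fst, lift_c1, Category.comp_id]
    · simp only [Category.assoc, tensorHom_snd, lift_snd, tangentLift_snd_fst, comp_toUnit_assoc]
  add := by
    let ρ := (isBundle_fst X (𝓛.L.obj X)).ρ 2
    have e1 : (prodSum X (𝓛.L.obj X) ≫ 𝓛.tangentLift X) ≫ fst _ _ =
        CartesianMonoidalCategory.lift ((ρ 0 ≫ 𝓛.tangentLift X) ≫ fst _ _ ≫ fst _ _)
          (CartesianMonoidalCategory.lift ((ρ 0 ≫ 𝓛.tangentLift X) ≫ fst _ _ ≫ snd _ _)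
            ((ρ 1 ≫ 𝓛.tangentLift X) ≫ fst _ _ ≫ snd _ _) ≫ μ[𝓛.L.obj X]) := by
      simp only [ρ, Category.assoc, lift_c1, lift_c2, tangentLift_fst,
        prodSum_fst, comp_lift, comp_toUnit_assoc, Category.comp_id, lift_comp_one_right, IsBundle.ρ_comp]
    have e2 : (prodSum X (𝓛.L.obj X) ≫ 𝓛.tangentLift X) ≫ snd _ _ ≫ 𝓛.L.map (fst _ _) =
        (ρ 0 ≫ 𝓛.tangentLift X) ≫ snd _ _ ≫ 𝓛.L.map (fst _ _) := by
      simp only [Category.assoc, tangentLift_snd_fst, comp_toUnit_assoc]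
    have e3 : (prodSum X (𝓛.L.obj X) ≫ 𝓛.tangentLift X) ≫ snd _ _ ≫ 𝓛.L.map (snd _ _) =
        CartesianMonoidalCategory.lift
          ((ρ 0 ≫ 𝓛.tangentLift X) ≫ snd _ _ ≫ 𝓛.L.map (snd _ _))
          ((ρ 1 ≫ 𝓛.tangentLift X) ≫ snd _ _ ≫ 𝓛.L.map (snd _ _)) ≫
            μ[𝓛.L.obj (𝓛.L.obj X)] := by
      simp only [ρ, Category.assoc, tangentLift_snd_snd,
        reassoc_of% prodSum_snd (X := X) (M := 𝓛.L.obj X), sum_ν_inv]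
    exact (AdditiveBundle.map_pair_add _ _ _ _ _ _).trans (𝓛.tangent_add_eq _ _ _ e1 e2 e3)
  zero := by
    have e : CartesianMonoidalCategory.lift (𝟙 X) (toUnit X ≫ η[𝓛.L.obj X]) ≫
        𝓛.tangentLift X = CartesianMonoidalCategory.lift (𝟙 X) (toUnit X ≫ η[𝓛.L.obj X]) ≫
        (CartesianMonoidalCategory.lift (𝟙 X) (toUnit X ≫ η[𝓛.L.obj X]) ⊗ₘ
          𝓛.L.map (CartesianMonoidalCategory.lift (𝟙 X) (toUnit X ≫ η[𝓛.L.obj X]))) := by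
      apply 𝓛.tangent_ext
      · simp only [Category.assoc, tangentLift_fst, tensorHom_fst]
      · simp only [Category.assoc, tangentLift_snd_fst, tensorHom_snd_assoc, ← Functor.map_comp,
          lift_fst, lift_snd, comp_toUnit_assoc, 𝓛.L.map_id, Category.comp_id]
      · simp only [Category.assoc, tangentLift_snd_snd, tensorHom_snd_assoc, ← Functor.map_comp,
          lift_snd, lift_snd_assoc, map_zero, comp_toUnit_assoc, zero_ν_inv]
    exact e

theorem tangentFlip_isHom (X : C) :
    ((𝓛.tangentBun X).map 𝓛.tangentFunctor (𝓛.tangentPreservesPow_one X)).IsHom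
      (𝓛.tangentBun (X ⊗ 𝓛.L.obj X)) (𝓛.tangentFlip X) (𝟙 (X ⊗ 𝓛.L.obj X)) where
  w := by
    change 𝓛.tangentFlip X ≫ fst _ _ = (fst _ _ ⊗ₘ 𝓛.L.map (fst _ _)) ≫ 𝟙 _
    rw [tangentFlip_fst]
    ext <;> simp
  add := by
    let hq := ((𝓛.tangentBun X).map 𝓛.tangentFunctor (𝓛.tangentPreservesPow_one X)).isBundle
    let ρ : Fin 2 → (hq.pow 2 ⟶ (X ⊗ 𝓛.L.obj X) ⊗ 𝓛.L.obj (X ⊗ 𝓛.L.obj X)) := hq.ρ 2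
    let r := CartesianMonoidalCategory.lift ((ρ 0 ≫ 𝓛.tangentFlip X) ≫ fst _ _)
      (CartesianMonoidalCategory.lift ((ρ 0 ≫ 𝓛.tangentFlip X) ≫ snd _ _)
        ((ρ 1 ≫ 𝓛.tangentFlip X) ≫ snd _ _) ≫ μ[𝓛.L.obj (X ⊗ 𝓛.L.obj X)])
    have e1 : (r ≫ 𝓛.tangentFlip X) ≫ fst _ _ =
        CartesianMonoidalCategory.lift (ρ 0 ≫ fst _ _ ≫ fst _ _)
          (CartesianMonoidalCategory.lift (ρ 0 ≫ fst _ _ ≫ snd _ _)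
            (ρ 1 ≫ fst _ _ ≫ snd _ _) ≫ μ[𝓛.L.obj X]) := by
      simp only [r, Category.assoc, tangentFlip_fst, comp_lift, lift_fst_assoc, lift_snd_assoc,
        sum_map, tangentFlip_snd_fst, lift_fst]
    have e2 : (r ≫ 𝓛.tangentFlip X) ≫ snd _ _ ≫ 𝓛.L.map (fst _ _) =
        ρ 0 ≫ snd _ _ ≫ 𝓛.L.map (fst _ _) := by
      simp only [r, Category.assoc, tangentFlip_snd_fst, lift_fst_assoc, flip_c2]
    have e3 : (r ≫ 𝓛.tangentFlip X) ≫ snd _ _ ≫ 𝓛.L.map (snd _ _) =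
        CartesianMonoidalCategory.lift (ρ 0 ≫ snd _ _ ≫ 𝓛.L.map (snd _ _))
          (ρ 1 ≫ snd _ _ ≫ 𝓛.L.map (snd _ _)) ≫ μ[𝓛.L.obj (𝓛.L.obj X)] := by
      simp only [r, Category.assoc, tangentFlip_snd_snd, lift_snd_assoc, sum_map]
    have e4 := 𝓛.tangent_add_eq (𝓛.tangentPreservesPow_one X) (isBundle_fst X (𝓛.L.obj X))
      (hq.ρ_comp_eq 2 0 1) e1 e2 e3
    have e5 : r = (r ≫ 𝓛.tangentFlip X) ≫ 𝓛.tangentFlip X := by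
      rw [Category.assoc, tangentFlip_flip, Category.comp_id]
    exact (pair_prodSum _ _ _).trans (e5.trans (congrArg (· ≫ 𝓛.tangentFlip X) e4.symm))
  zero := by
    have e : (CartesianMonoidalCategory.lift (𝟙 X) (toUnit X ≫ η[𝓛.L.obj X]) ⊗ₘ
          𝓛.L.map (CartesianMonoidalCategory.lift (𝟙 X) (toUnit X ≫ η[𝓛.L.obj X]))) ≫
        𝓛.tangentFlip X = 𝟙 (X ⊗ 𝓛.L.obj X) ≫ CartesianMonoidalCategory.lift
          (𝟙 (X ⊗ 𝓛.L.obj X)) (toUnit (X ⊗ 𝓛.L.obj X) ≫ η[𝓛.L.obj (X ⊗ 𝓛.L.obj X)]) := by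
      apply 𝓛.tangent_ext
      · simp only [Category.assoc, tangentFlip_fst, comp_lift, tensorHom_fst_assoc, lift_fst,
          tensorHom_snd_assoc, ← Functor.map_comp, Category.comp_id, Category.id_comp]
        ext <;> simp
      · simp only [Category.assoc, tangentFlip_snd_fst, tensorHom_fst_assoc, lift_snd,
          lift_snd_assoc, Category.id_comp, zero_map, comp_toUnit_assoc]
      · simp only [Category.assoc, tangentFlip_snd_snd, tensorHom_snd_assoc, ← Functor.map_comp,
          lift_snd, lift_snd_assoc, map_zero, comp_toUnit_assoc, Category.id_comp, zero_map]
    exact e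

theorem isPullback_of_components {X : C}
    (V : (isBundle_fst X (𝓛.L.obj X)).pow 2 ⟶
      (X ⊗ 𝓛.L.obj X) ⊗ 𝓛.L.obj (X ⊗ 𝓛.L.obj X))
    (h1 : V ≫ fst _ _ = (isBundle_fst X (𝓛.L.obj X)).ρ 2 1)
    (h2 : V ≫ snd _ _ ≫ 𝓛.L.map (fst _ _) = toUnit _ ≫ η[𝓛.L.obj X])
    (h3 : V ≫ snd _ _ ≫ 𝓛.L.map (snd _ _) =
      (isBundle_fst X (𝓛.L.obj X)).ρ 2 0 ≫ snd _ _ ≫ 𝓛.ν.inv.app X) :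
    IsPullback V ((isBundle_fst X (𝓛.L.obj X)).ρ 2 0 ≫ fst _ _)
      (fst X (𝓛.L.obj X) ⊗ₘ 𝓛.L.map (fst X (𝓛.L.obj X)))
      (CartesianMonoidalCategory.lift (𝟙 X) (toUnit X ≫ η[𝓛.L.obj X])) := by
  have hν : 𝓛.ν.hom.app X ≫ 𝓛.ν.inv.app X = 𝟙 (𝓛.L.obj (𝓛.L.obj X)) := Iso.hom_inv_id_app _ _
  have hν' : 𝓛.ν.inv.app X ≫ 𝓛.ν.hom.app X = 𝟙 (𝓛.L.obj X) := Iso.inv_hom_id_app _ _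
  have key : ∀ {W : C} (f : W ⟶ (X ⊗ 𝓛.L.obj X) ⊗ 𝓛.L.obj (X ⊗ 𝓛.L.obj X)) (g : W ⟶ X),
      f ≫ (fst X (𝓛.L.obj X) ⊗ₘ 𝓛.L.map (fst X (𝓛.L.obj X))) =
        g ≫ CartesianMonoidalCategory.lift (𝟙 X) (toUnit X ≫ η[𝓛.L.obj X]) →
      f ≫ fst _ _ ≫ fst _ _ = g ∧ f ≫ snd _ _ ≫ 𝓛.L.map (fst _ _) =
        toUnit _ ≫ η[𝓛.L.obj X] := by
    intro W f g h
    have a1 := congrArg (· ≫ fst _ _) h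
    have a2 := congrArg (· ≫ snd _ _) h
    simp only [Category.assoc, tensorHom_fst, tensorHom_snd, lift_fst, lift_snd,
      Category.comp_id, comp_toUnit_assoc] at a1 a2
    exact ⟨a1, a2⟩
  refine ⟨⟨?_⟩, ⟨PullbackCone.IsLimit.mk _
    (fun s => (isBundle_fst X (𝓛.L.obj X)).pair
      (CartesianMonoidalCategory.lift s.snd (s.fst ≫ snd _ _ ≫ 𝓛.L.map (snd _ _) ≫
        𝓛.ν.hom.app X)) (s.fst ≫ fst _ _)
      (by rw [lift_fst, Category.assoc, (key _ _ s.condition).1])) ?_ ?_ ?_⟩⟩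
  · ext
    · simp only [Category.assoc, tensorHom_fst, lift_fst, reassoc_of% h1, Category.comp_id,
        IsBundle.ρ_comp]
    · simp only [Category.assoc, tensorHom_snd, lift_snd, h2, comp_toUnit_assoc]
  · intro s
    refine 𝓛.tangent_ext ?_ ?_ ?_
    · rw [Category.assoc, h1, IsBundle.pair_ρ1]
    · rw [Category.assoc, h2, comp_toUnit_assoc, (key _ _ s.condition).2]
    · rw [Category.assoc, h3, ← Category.assoc, IsBundle.pair_ρ0, lift_snd_assoc]
      simp only [Category.assoc]
      refine congrArg (fun k => s.fst ≫ snd _ _ ≫ k) ?_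
      exact (congrArg (𝓛.L.map (snd _ _) ≫ ·) hν).trans (Category.comp_id _)
  · intro s
    rw [← Category.assoc, IsBundle.pair_ρ0, lift_fst]
  · intro s m m1 m2
    apply (isBundle_fst X (𝓛.L.obj X)).pow2_ext
    · rw [IsBundle.pair_ρ0]
      apply CartesianMonoidalCategory.hom_ext
      · rw [Category.assoc, m2, lift_fst]
      · rw [lift_snd, ← m1, Category.assoc, Category.assoc, reassoc_of% h3]
        refine congrArg (fun k => m ≫ (isBundle_fst X (𝓛.L.obj X)).ρ 2 0 ≫ k) ?_
        exact ((congrArg (snd X (𝓛.L.obj X) ≫ ·) hν').trans (Category.comp_id _)).symm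
    · rw [IsBundle.pair_ρ1, ← m1, Category.assoc, h1]

theorem tangent_universal (X : C)
    (hu : 𝓛.tangentLift X ≫ 𝓛.tangentFunctor.map (fst X (𝓛.L.obj X)) =
      fst X (𝓛.L.obj X) ≫ (𝓛.tangentBun X).zero)
    (hv : (𝓛.tangentBun (X ⊗ 𝓛.L.obj X)).zero ≫ 𝓛.tangentFunctor.map (fst X (𝓛.L.obj X)) =
      fst X (𝓛.L.obj X) ≫ (𝓛.tangentBun X).zero) :
    IsPullback ((𝓛.tangentBun X).vertical 𝓛.tangentFunctor (𝓛.tangentPreservesPow_one X)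
        (𝓛.tangentLift X) (𝓛.tangentBun (X ⊗ 𝓛.L.obj X)).zero (𝓛.tangentBun X).zero hu hv)
      ((𝓛.tangentBun X).isBundle.ρ 2 0 ≫ fst X (𝓛.L.obj X))
      (𝓛.tangentFunctor.map (fst X (𝓛.L.obj X))) (𝓛.tangentBun X).zero := by
  let ρ := (isBundle_fst X (𝓛.L.obj X)).ρ 2
  let a := ρ 0 ≫ 𝓛.tangentLift X
  let b := ρ 1 ≫ CartesianMonoidalCategory.lift (𝟙 (X ⊗ 𝓛.L.obj X))
    (toUnit _ ≫ η[𝓛.L.obj (X ⊗ 𝓛.L.obj X)])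
  let r := CartesianMonoidalCategory.lift (ρ 1)
    (CartesianMonoidalCategory.lift (toUnit _ ≫ η[𝓛.L.obj X])
      (ρ 0 ≫ snd _ _ ≫ 𝓛.ν.inv.app X) ≫
      inv (CartesianMonoidalCategory.prodComparison 𝓛.L X (𝓛.L.obj X)))
  have r1 : r ≫ fst _ _ = ρ 1 := lift_fst _ _
  have r2 : r ≫ snd _ _ ≫ 𝓛.L.map (fst _ _) = toUnit _ ≫ η[𝓛.L.obj X] := by simp [r]
  have r3 : r ≫ snd _ _ ≫ 𝓛.L.map (snd _ _) = ρ 0 ≫ snd _ _ ≫ 𝓛.ν.inv.app X := by simp [r]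
  have e1 : r ≫ fst _ _ = CartesianMonoidalCategory.lift (a ≫ fst _ _ ≫ fst _ _)
      (CartesianMonoidalCategory.lift (a ≫ fst _ _ ≫ snd _ _) (b ≫ fst _ _ ≫ snd _ _) ≫
        μ[𝓛.L.obj X]) := by
    rw [r1]
    simp only [a, b, Category.assoc, lift_c1, lift_c2, lift_fst_assoc, Category.id_comp,
      comp_toUnit_assoc, lift_comp_one_left]
    apply CartesianMonoidalCategory.hom_ext
    · rw [lift_fst]
      exact (isBundle_fst X (𝓛.L.obj X)).ρ_comp_eq 2 1 0
    · rw [lift_snd]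
  have e2 : r ≫ snd _ _ ≫ 𝓛.L.map (fst _ _) = a ≫ snd _ _ ≫ 𝓛.L.map (fst _ _) := by
    rw [r2]
    simp only [a, Category.assoc, tangentLift_snd_fst, comp_toUnit_assoc]
  have e3 : r ≫ snd _ _ ≫ 𝓛.L.map (snd _ _) =
      CartesianMonoidalCategory.lift (a ≫ snd _ _ ≫ 𝓛.L.map (snd _ _))
        (b ≫ snd _ _ ≫ 𝓛.L.map (snd _ _)) ≫ μ[𝓛.L.obj (𝓛.L.obj X)] := by
    rw [r3]
    simp only [a, b, Category.assoc, tangentLift_snd_snd, lift_snd_assoc, zero_map,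
      comp_toUnit_assoc, lift_comp_one_right]
  have hV : (𝓛.tangentBun X).vertical 𝓛.tangentFunctor (𝓛.tangentPreservesPow_one X)
      (𝓛.tangentLift X) (𝓛.tangentBun (X ⊗ 𝓛.L.obj X)).zero (𝓛.tangentBun X).zero hu hv = r :=
    𝓛.tangent_add_eq (𝓛.tangentPreservesPow_one X) (isBundle_fst X (𝓛.L.obj X))
      (a := a) (b := b) _ e1 e2 e3
  rw [hV]
  exact 𝓛.isPullback_of_components r r1 r2 r3

/-- The tangent structure induced by a linear assignment. -/
def tangentStructure : TangentStructure C where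
  T := 𝓛.tangentFunctor
  p X := fst X (𝓛.L.obj X)
  bun := 𝓛.tangentBun
  preservesPow := 𝓛.tangentPreservesPow
  bun_naturality f := prodBundle_isHom f (𝓛.L.map f)
  l := 𝓛.tangentLift
  l_naturality := 𝓛.tangentLift_naturality
  l_isHom := 𝓛.tangentLift_isHom
  l_l := 𝓛.tangent_lift_lift
  l_universal X := 𝓛.tangent_universal X _ _
  c := 𝓛.tangentFlip
  c_naturality := 𝓛.tangentFlip_naturality
  c_c := 𝓛.tangentFlip_flip
  yang_baxter := 𝓛.tangent_yang_baxter
  c_isHom := 𝓛.tangentFlip_isHom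
  l_c := 𝓛.tangentLift_flip
  l_c_c := 𝓛.tangent_lift_flip_flip

instance : PreservesFiniteProducts 𝓛.tangentStructure.T :=
  inferInstanceAs (PreservesFiniteProducts 𝓛.tangentFunctor)

end LinearAssignment

namespace AdditiveAssignment

variable (𝓛 : AdditiveAssignment C)

theorem tangent_add_neg (X : C) :
    CartesianMonoidalCategory.lift (𝟙 (X ⊗ 𝓛.L.obj X) ≫ fst _ _)
      (CartesianMonoidalCategory.lift (𝟙 (X ⊗ 𝓛.L.obj X) ≫ snd _ _)
        ((𝟙 X ⊗ₘ 𝓛.neg.app X) ≫ snd _ _) ≫ μ[𝓛.L.obj X]) =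
      fst X (𝓛.L.obj X) ≫
        CartesianMonoidalCategory.lift (𝟙 X) (toUnit X ≫ η[𝓛.L.obj X]) := by
  have h := congrArg (snd X (𝓛.L.obj X) ≫ ·) (𝓛.add_neg X)
  simp only [comp_lift_assoc, Category.comp_id] at h
  simp [h]

theorem tangent_neg_add (X : C) :
    CartesianMonoidalCategory.lift ((𝟙 X ⊗ₘ 𝓛.neg.app X) ≫ fst _ _)
      (CartesianMonoidalCategory.lift ((𝟙 X ⊗ₘ 𝓛.neg.app X) ≫ snd _ _)
        (𝟙 (X ⊗ 𝓛.L.obj X) ≫ snd _ _) ≫ μ[𝓛.L.obj X]) =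
      fst X (𝓛.L.obj X) ≫
        CartesianMonoidalCategory.lift (𝟙 X) (toUnit X ≫ η[𝓛.L.obj X]) := by
  have h := congrArg (snd X (𝓛.L.obj X) ≫ ·) (𝓛.neg_add X)
  simp only [comp_lift_assoc, Category.comp_id] at h
  simp [h]

/-- The Rosický tangent structure induced by an additive assignment, with negative `1 × (-)`. -/
def rosickyTangentStructure : RosickyTangentStructure C where
  toTangentStructure := 𝓛.tangentStructure
  n X := 𝟙 X ⊗ₘ 𝓛.neg.app X
  n_naturality f := by
    change (f ⊗ₘ 𝓛.L.map f) ≫ (𝟙 _ ⊗ₘ 𝓛.neg.app _) = (𝟙 _ ⊗ₘ 𝓛.neg.app _) ≫ (f ⊗ₘ 𝓛.L.map f)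
    apply CartesianMonoidalCategory.hom_ext <;> simp
  n_proj X := (tensorHom_fst _ _).trans (Category.comp_id _)
  add_n X := (pair_prodSum (X := X) (M := 𝓛.L.obj X) _ _ _).trans (𝓛.tangent_add_neg X)
  n_add X := (pair_prodSum (X := X) (M := 𝓛.L.obj X) _ _ _).trans (𝓛.tangent_neg_add X)

instance : PreservesFiniteProducts 𝓛.rosickyTangentStructure.T :=
  inferInstanceAs (PreservesFiniteProducts 𝓛.tangentFunctor)

end AdditiveAssignment

end Assignments

end TangentCat

end

-- Everything collapses over the terminal object. As `L` preserves finite products, `L(1)` is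
-- terminal, hence so is `T(1) = 1 × L(1)`, and the zero section `1 ⟶ T(1)` is invertible. A
-- differential object is thus an object `E` with a commutative monoid structure and a lift `λ : E ⟶
-- E × L(E)`. Since `λ` lies over the zero of `E`, its first component is the constant zero, and
-- only the second component `u : E ⟶ L(E)` (`objCoaction`) carries information.
--
-- The universality square has an invertible bottom edge, so it is a pullback exactly when its top
-- edge `E_2 ⟶ E × L(E)` is invertible. In components this edge is `(x, y) ↦ (y, u x)`
-- (`vertical_fst`, `vertical_snd`), so the condition says that `u` is an isomorphism. The last
-- component of the coherence between the lift and `ℓ` then reads `L(u) u = ν⁻¹ u`; cancelling `u`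
-- gives `L(u⁻¹) = ν`, the algebra axiom for `u⁻¹` (`map_objCoaction`). Additivity of `λ` into
-- `T(E)` makes `u` a monoid morphism, so the sum and the zero of `E` are those of `L(E)`
-- transported along `u`: they are no extra data.
--
-- Conversely, an algebra `(A, a)` receives the monoid structure of `L(A)` along `a` and the lift
-- `⟨0, a⁻¹⟩`. The substantial point is additivity of this lift into the image of the bundle under
-- `T`: it holds because the image under `L` of the transported sum is the sum of `L(A)`
-- (`Algebra.map_add_snd`), by additivity of `ν`.
--
-- A morphism commutes with lifts iff it commutes with the maps `u`, as compatibility with zeros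
-- follows. So `toAlgebra` is fully faithful and bijective on objects, which gives an isomorphism of
-- categories and not just an equivalence.

universe w

noncomputable section

namespace TangentCat

/-! ### Isomorphisms of categories, and pullback powers under isomorphism over the base -/

section

variable {C : Type u} [Category.{v} C]

/-- A fully faithful functor which is bijective on objects is an isomorphism of categories. -/
theorem nonempty_cat_iso {A B : Type w} [Category.{v} A] [Category.{v} B] (F : A ⥤ B)
    [F.Full] [F.Faithful] (h : Function.Bijective F.obj) :
    Nonempty (Cat.of A ≅ Cat.of B) := by
  have : F.IsIso := { bijective_obj := h }
  let e := F.asIsomorphism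
  exact ⟨⟨F.toCatHom, e.inverse.toCatHom, Cat.Hom.ext e.unit_eq.symm, Cat.Hom.ext e.counit_eq⟩⟩

/-- Pullback powers of isomorphic morphisms over `X` have isomorphic diagrams. -/
def powDiagramIso {E E' X : C} {q : E ⟶ X} {q' : E' ⟶ X} (e : E ≅ E') (h : e.hom ≫ q' = q)
    (n : ℕ) : powDiagram q n ≅ powDiagram q' n :=
  WidePullbackShape.functorExt (Iso.refl _) (fun _ => e) (fun _ => by
    change q ≫ 𝟙 X = e.hom ≫ q'
    rw [h, Category.comp_id])

theorem IsBundle.of_iso {E E' X : C} {q : E ⟶ X} {q' : E' ⟶ X} (e : E ≅ E')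
    (h : e.hom ≫ q' = q) (hq : IsBundle q) : IsBundle q' where
  hasPow n :=
    haveI := hq.hasPow n
    hasLimit_of_iso (powDiagramIso e h n)

theorem PreservesPow.of_iso {F : C ⥤ C} {E E' X : C} {q : E ⟶ X} {q' : E' ⟶ X} (e : E ≅ E')
    (h : e.hom ≫ q' = q) (hF : PreservesPow F q) : PreservesPow F q' where
  preserves n :=
    haveI := hF.preserves n
    preservesLimit_of_iso_diagram F (powDiagramIso e h n)

end

/-! ### Additive bundles over the terminal object -/

section

variable {C : Type u} [Category.{v} C] [CartesianMonoidalCategory C]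

/-- The left unitor identifies `A ⟶ 𝟙` with the projection `𝟙 × A ⟶ 𝟙`, whose powers exist and are
preserved by product-preserving functors. -/
theorem isBundle_toUnit (A : C) : IsBundle (toUnit A) :=
  .of_iso (λ_ A) (toUnit_unique _ _) (isBundle_fst (𝟙_ C) A)

theorem preservesPow_toUnit (F : C ⥤ C) [PreservesFiniteProducts F] (A : C) :
    PreservesPow F (toUnit A) :=
  .of_iso (λ_ A) (toUnit_unique _ _) (preservesPow_fst F (𝟙_ C) A)

variable [BraidedCategory C]

/-- The additive bundle `A ⟶ 𝟙` whose sum and zero are transported along an isomorphism from a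
commutative monoid to `A`. -/
def toUnitBundle {M A : C} [MonObj M] [IsCommMonObj M] (a : M ≅ A) :
    AdditiveBundle (toUnit A) where
  isBundle := isBundle_toUnit A
  add := CartesianMonoidalCategory.lift ((isBundle_toUnit A).ρ 2 0 ≫ a.inv)
    ((isBundle_toUnit A).ρ 2 1 ≫ a.inv) ≫ μ[M] ≫ a.hom
  zero := η[M] ≫ a.hom
  add_proj _ := toUnit_unique _ _
  zero_proj := toUnit_unique _ _
  add_assoc := by
    simp only [comp_lift_assoc, reassoc_of% IsBundle.pair_ρ0, reassoc_of% IsBundle.pair_ρ1,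
      Category.assoc, Iso.hom_inv_id, Category.comp_id, reassoc_of% @MonObj.lift_lift_assoc]
  zero_add := by
    simp only [comp_lift_assoc, reassoc_of% IsBundle.pair_ρ0, reassoc_of% IsBundle.pair_ρ1,
      Category.assoc, Iso.hom_inv_id, Category.comp_id, Category.id_comp]
    rw [lift_comp_one_left_assoc, Iso.inv_hom_id]
  add_zero := by
    simp only [comp_lift_assoc, reassoc_of% IsBundle.pair_ρ0, reassoc_of% IsBundle.pair_ρ1,
      Category.assoc, Iso.hom_inv_id, Category.comp_id, Category.id_comp]
    rw [lift_comp_one_right_assoc, Iso.inv_hom_id]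
  add_comm := by
    simp only [comp_lift_assoc, reassoc_of% IsBundle.pair_ρ0, reassoc_of% IsBundle.pair_ρ1]
    -- Commutativity is applied on one side only: the braiding it inserts there exchanges the two
    -- entries of the pairing.
    conv_rhs => rw [← IsCommMonObj.mul_comm M]
    rw [Category.assoc, lift_braiding_hom_assoc]

theorem pair_toUnitBundle_add {M A W : C} [MonObj M] [IsCommMonObj M] (a : M ≅ A)
    (x y : W ⟶ A) (h : x ≫ toUnit A = y ≫ toUnit A) :
    (toUnitBundle a).isBundle.pair x y h ≫ (toUnitBundle a).add =
      CartesianMonoidalCategory.lift (x ≫ a.inv) (y ≫ a.inv) ≫ μ[M] ≫ a.hom := by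
  simp only [toUnitBundle, comp_lift_assoc, reassoc_of% IsBundle.pair_ρ0,
    reassoc_of% IsBundle.pair_ρ1]

end

/-! ### The universality square over the terminal object -/

namespace LinearAssignment

variable {C : Type u} [Category.{v} C] [CartesianMonoidalCategory C] [BraidedCategory C]
  (𝓛 : LinearAssignment C)

/-- `L(1)` is terminal, so `T(1)` is too. This is what turns universality of a lift into
invertibility of the top edge of its square. -/
instance isIso_tangentBun_unit_zero : IsIso (𝓛.tangentBun (𝟙_ C)).zero :=
  ⟨toUnit _, toUnit_unique _ _, CartesianMonoidalCategory.hom_ext _ _ (toUnit_unique _ _)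
    (𝓛.hom_unit_ext _ _)⟩

section

variable {𝓛} {E W : C} {q : E ⟶ 𝟙_ C} (B : AdditiveBundle q)

section

variable {k : W ⟶ B.isBundle.pow 2 ⊗ 𝓛.L.obj (B.isBundle.pow 2)} {x y : W ⟶ E ⊗ 𝓛.L.obj E}

/-- Here `k` plays the role of the pairing of `x` and `y` in `T(E_2)`, so composing with the image
under `T` of the sum adds two tangent vectors; their base points are added in `E`. -/
theorem map_add_fst
    (hx : k ≫ (B.isBundle.ρ 2 0 ⊗ₘ 𝓛.L.map (B.isBundle.ρ 2 0)) = x)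
    (hy : k ≫ (B.isBundle.ρ 2 1 ⊗ₘ 𝓛.L.map (B.isBundle.ρ 2 1)) = y) :
    (k ≫ (B.add ⊗ₘ 𝓛.L.map B.add)) ≫ fst _ _ =
      B.isBundle.pair (x ≫ fst _ _) (y ≫ fst _ _) (toUnit_unique _ _) ≫ B.add := by
  rw [Category.assoc, tensorHom_fst, ← Category.assoc]
  congr 1
  subst hx hy
  apply B.isBundle.pow2_ext <;>
    simp only [Category.assoc, tensorHom_fst, IsBundle.pair_ρ0, IsBundle.pair_ρ1]

/-- Adding a tangent vector whose second component is zero does not change the second component. -/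
theorem map_add_snd_of_eq_zero
    (hx : k ≫ (B.isBundle.ρ 2 0 ⊗ₘ 𝓛.L.map (B.isBundle.ρ 2 0)) = x)
    (hy : k ≫ (B.isBundle.ρ 2 1 ⊗ₘ 𝓛.L.map (B.isBundle.ρ 2 1)) = y)
    (hF : PreservesPow 𝓛.tangentFunctor q)
    (h0 : y ≫ snd _ _ = toUnit _ ≫ η[𝓛.L.obj E]) :
    (k ≫ (B.add ⊗ₘ 𝓛.L.map B.add)) ≫ snd _ _ = x ≫ snd _ _ := by
  -- `T` preserves `E_2`, so the images of its two projections under `T` are jointly monic.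
  have ext : ∀ k' : W ⟶ B.isBundle.pow 2 ⊗ 𝓛.L.obj (B.isBundle.pow 2),
      k ≫ (B.isBundle.ρ 2 0 ⊗ₘ 𝓛.L.map (B.isBundle.ρ 2 0)) =
        k' ≫ (B.isBundle.ρ 2 0 ⊗ₘ 𝓛.L.map (B.isBundle.ρ 2 0)) →
      k ≫ (B.isBundle.ρ 2 1 ⊗ₘ 𝓛.L.map (B.isBundle.ρ 2 1)) =
        k' ≫ (B.isBundle.ρ 2 1 ⊗ₘ 𝓛.L.map (B.isBundle.ρ 2 1)) → k = k' :=
    fun _ => hF.pow2_ext B.isBundle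
  -- The section `x ↦ (x, 0)` of the first projection; the sum retracts it.
  let s := B.isBundle.pair (𝟙 E) (q ≫ B.zero) (toUnit_unique _ _)
  -- The image factors through the terminal object `L(1)`, and naturality of `0` carries the zero of
  -- `L(1)` to that of `L(E)`.
  have h0' : 𝓛.L.map (q ≫ B.zero) = toUnit _ ≫ η[𝓛.L.obj E] := by
    rw [← 𝓛.zero_map B.zero, Functor.map_comp, ← Category.assoc]
    congr 1
    exact 𝓛.hom_unit_ext _ _
  have hx1 : k ≫ fst _ _ ≫ B.isBundle.ρ 2 0 = x ≫ fst _ _ := by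
    rw [← hx, Category.assoc, tensorHom_fst]
  have hy1 : k ≫ fst _ _ ≫ B.isBundle.ρ 2 1 = y ≫ fst _ _ := by
    rw [← hy, Category.assoc, tensorHom_fst]
  -- Since the second component of `y` vanishes, the `L(E_2)`-component of `k` must come from that
  -- of `x` through `L(s)`; applying the sum then undoes `s`. No formula for `L` of the sum is
  -- needed.
  have e : k = CartesianMonoidalCategory.lift (k ≫ fst _ _) (x ≫ snd _ _ ≫ 𝓛.L.map s) := by
    apply ext
    · rw [hx, lift_map, Category.assoc, Category.assoc, Category.assoc, ← Functor.map_comp,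
        IsBundle.pair_ρ0, CategoryTheory.Functor.map_id, Category.comp_id, hx1, ← comp_lift,
        lift_fst_snd, Category.comp_id]
    · rw [hy, lift_map, Category.assoc, Category.assoc, Category.assoc, ← Functor.map_comp,
        IsBundle.pair_ρ1, h0', hy1, comp_toUnit_assoc, comp_toUnit_assoc, ← h0, ← comp_lift,
        lift_fst_snd, Category.comp_id]
  rw [Category.assoc, tensorHom_snd, e, lift_snd_assoc]
  simp only [Category.assoc, ← Functor.map_comp, s, B.add_zero, CategoryTheory.Functor.map_id,
    Category.comp_id]

end

section

variable {u : E ⟶ E ⊗ 𝓛.L.obj E} {V : B.isBundle.pow 2 ⟶ E ⊗ 𝓛.L.obj E}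

/-- The vector `u x` has base point zero and the zero vector at `y` has base point `y`, and `0 + y =
y`. Passing `V` with an equation displays its codomain as a product. -/
theorem vertical_fst (hF : PreservesPow 𝓛.tangentFunctor q)
    (hu : u ≫ 𝓛.tangentFunctor.map q = q ≫ (𝓛.tangentBun (𝟙_ C)).zero)
    (hv : (𝓛.tangentBun E).zero ≫ 𝓛.tangentFunctor.map q = q ≫ (𝓛.tangentBun (𝟙_ C)).zero)
    (hV : V = B.vertical 𝓛.tangentFunctor hF u (𝓛.tangentBun E).zero (𝓛.tangentBun (𝟙_ C)).zero
      hu hv) (hu0 : u ≫ fst _ _ = q ≫ B.zero) : V ≫ fst _ _ = B.isBundle.ρ 2 1 := by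
  subst hV
  refine (map_add_fst B (hF.pair_ρ0 B.isBundle _ _ _) (hF.pair_ρ1 B.isBundle _ _ _)).trans ?_
  have e : B.isBundle.pair ((B.isBundle.ρ 2 0 ≫ u) ≫ fst _ _)
      ((B.isBundle.ρ 2 1 ≫ (𝓛.tangentBun E).zero) ≫ fst _ _) (toUnit_unique _ _) =
      B.isBundle.ρ 2 1 ≫ B.isBundle.pair (q ≫ B.zero) (𝟙 E) (toUnit_unique _ _) := by
    apply B.isBundle.pow2_ext
    · simp only [Category.assoc, IsBundle.pair_ρ0, hu0, reassoc_of% B.isBundle.ρ_comp_eq 2 0 1]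
    · simp only [Category.assoc, IsBundle.pair_ρ1]
      exact congrArg _ (𝓛.tangentBun E).zero_proj
  refine (congrArg (· ≫ B.add) e).trans ?_
  simp only [Category.assoc, B.zero_add, Category.comp_id]

/-- The zero vector at `y` has vanishing second component, so `map_add_snd_of_eq_zero` applies. -/
theorem vertical_snd (hF : PreservesPow 𝓛.tangentFunctor q)
    (hu : u ≫ 𝓛.tangentFunctor.map q = q ≫ (𝓛.tangentBun (𝟙_ C)).zero)
    (hv : (𝓛.tangentBun E).zero ≫ 𝓛.tangentFunctor.map q = q ≫ (𝓛.tangentBun (𝟙_ C)).zero)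
    (hV : V = B.vertical 𝓛.tangentFunctor hF u (𝓛.tangentBun E).zero (𝓛.tangentBun (𝟙_ C)).zero
      hu hv) : V ≫ snd _ _ = B.isBundle.ρ 2 0 ≫ u ≫ snd _ _ := by
  subst hV
  refine (map_add_snd_of_eq_zero B (hF.pair_ρ0 B.isBundle _ _ _) (hF.pair_ρ1 B.isBundle _ _ _) hF
    ?_).trans (Category.assoc _ _ _)
  have e : (𝓛.tangentBun E).zero ≫ snd _ _ = toUnit _ ≫ η[𝓛.L.obj E] := lift_snd _ _
  refine (Category.assoc _ _ _).trans ((congrArg (B.isBundle.ρ 2 1 ≫ ·) e).trans ?_)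
  simp only [comp_toUnit_assoc]

/-- With `w` the second component of `u`, the map is `(x, y) ↦ (y, w x)`, with inverse `(y, b) ↦
(w⁻¹ b, y)`. -/
theorem isIso_vertical (V1 : V ≫ fst _ _ = B.isBundle.ρ 2 1)
    (V2 : V ≫ snd _ _ = B.isBundle.ρ 2 0 ≫ u ≫ snd _ _) [IsIso (u ≫ snd _ _)] : IsIso V := by
  refine ⟨B.isBundle.pair (snd _ _ ≫ inv (u ≫ snd _ _)) (fst _ _) (toUnit_unique _ _), ?_, ?_⟩
  · apply B.isBundle.pow2_ext
    · rw [Category.assoc, IsBundle.pair_ρ0, reassoc_of% V2, ← Category.assoc u,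
        IsIso.hom_inv_id, Category.comp_id, Category.id_comp]
    · rw [Category.assoc, IsBundle.pair_ρ1, V1, Category.id_comp]
  · apply CartesianMonoidalCategory.hom_ext
    · rw [Category.assoc, V1, IsBundle.pair_ρ1, Category.id_comp]
    · rw [Category.assoc, V2, ← Category.assoc, IsBundle.pair_ρ0, Category.assoc,
        IsIso.inv_hom_id, Category.comp_id, Category.id_comp]

/-- The inverse of the second component sends `b` to the first entry of `V⁻¹(0, b)`. -/
theorem isIso_snd_of_isIso_vertical (V1 : V ≫ fst _ _ = B.isBundle.ρ 2 1)
    (V2 : V ≫ snd _ _ = B.isBundle.ρ 2 0 ≫ u ≫ snd _ _)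
    [IsIso V] : IsIso (u ≫ snd _ _) := by
  refine ⟨CartesianMonoidalCategory.lift (toUnit _ ≫ B.zero) (𝟙 _) ≫ inv V ≫ B.isBundle.ρ 2 0,
    ?_, ?_⟩
  -- Both sides express `V(x, 0)`.
  · have e : (u ≫ snd _ _) ≫ CartesianMonoidalCategory.lift (toUnit _ ≫ B.zero) (𝟙 _) =
        B.isBundle.pair (𝟙 E) (q ≫ B.zero) (toUnit_unique _ _) ≫ V := by
      apply CartesianMonoidalCategory.hom_ext
      · rw [Category.assoc, Category.assoc, Category.assoc, V1, IsBundle.pair_ρ1, lift_fst,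
          comp_toUnit_assoc, comp_toUnit_assoc]
        exact congrArg (· ≫ B.zero) (toUnit_unique _ _)
      · rw [Category.assoc, Category.assoc, Category.assoc, V2,
          ← Category.assoc (B.isBundle.pair _ _ _),
          IsBundle.pair_ρ0, lift_snd, Category.comp_id, Category.id_comp]
    rw [← Category.assoc, e, Category.assoc, IsIso.hom_inv_id_assoc, IsBundle.pair_ρ0]
  · simp only [Category.assoc]
    rw [← V2, IsIso.inv_hom_id_assoc, lift_snd]

end

end

end LinearAssignment

/-! ### From differential objects to algebras -/

namespace LinearAssignment

variable {C : Type u} [Category.{v} C] [CartesianMonoidalCategory C] [BraidedCategory C]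
  {𝓛 : LinearAssignment C}

section

variable {E : C} {q : E ⟶ 𝟙_ C} {B : AdditiveBundle q} {u : E ⟶ E ⊗ 𝓛.L.obj E}

/-- The fibrewise operations of `T(E)` are those of `L(E)` on second components. Together with
`add_comp_snd`, this makes the second component of `u` a monoid morphism, from which the structure
of `E` can be recovered. -/
theorem zero_comp_snd (h : B.IsHom (𝓛.tangentBun E) u B.zero) :
    B.zero ≫ u ≫ snd _ _ = η[𝓛.L.obj E] := by
  have e : (𝓛.tangentBun E).zero ≫ snd _ _ = toUnit _ ≫ η[𝓛.L.obj E] := lift_snd _ _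
  have h0 := congrArg (· ≫ snd E (𝓛.L.obj E)) h.zero
  simp only [Category.assoc, e] at h0
  rw [h0, comp_toUnit_assoc, toUnit_unique (toUnit _) (𝟙 _), Category.id_comp]

theorem add_comp_snd (h : B.IsHom (𝓛.tangentBun E) u B.zero) :
    B.add ≫ u ≫ snd _ _ = CartesianMonoidalCategory.lift (B.isBundle.ρ 2 0 ≫ u ≫ snd _ _)
      (B.isBundle.ρ 2 1 ≫ u ≫ snd _ _) ≫ μ[𝓛.L.obj E] := by
  have h0 := congrArg (· ≫ snd E (𝓛.L.obj E)) ((pair_prodSum _ _ _).symm.trans h.add)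
  simp only [Category.assoc, lift_snd] at h0
  exact h0.symm

/-- The sum and the zero of an additive bundle over `𝟙` are determined by a monomorphism to `L E`
compatible with them. -/
theorem additiveBundle_ext {B' : AdditiveBundle q} (w : E ⟶ 𝓛.L.obj E) [Mono w]
    (hz : B.zero ≫ w = B'.zero ≫ w) (ha : B.add ≫ w = B'.add ≫ w) : B = B' :=
  AdditiveBundle.ext ((cancel_mono w).1 ha) ((cancel_mono w).1 hz)

end

section

variable (D : DifferentialBundle 𝓛.tangentStructure (𝟙_ C))

/-- The lift of a differential object, as a morphism `E ⟶ E × L E`. -/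
def objLift : D.E ⟶ D.E ⊗ 𝓛.L.obj D.E := D.lift

/-- The second component `E ⟶ L E` of the lift of a differential object. -/
def objCoaction : D.E ⟶ 𝓛.L.obj D.E := objLift D ≫ snd _ _

theorem objLift_fst : objLift D ≫ fst _ _ = D.q ≫ D.bun.zero := D.lift_isHom_bun.w

/-- The base point of the lift is forced by additivity over the zero of `E`, so the coaction is all
that is left of it. -/
theorem objLift_eq : objLift D = CartesianMonoidalCategory.lift (D.q ≫ D.bun.zero)
    (objCoaction D) :=
  CartesianMonoidalCategory.hom_ext _ _ ((objLift_fst D).trans (lift_fst _ _).symm)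
    (lift_snd _ _).symm

theorem zero_objCoaction : D.bun.zero ≫ objCoaction D = η[𝓛.L.obj D.E] :=
  zero_comp_snd D.lift_isHom_bun

theorem add_objCoaction : D.bun.add ≫ objCoaction D =
    CartesianMonoidalCategory.lift (D.bun.isBundle.ρ 2 0 ≫ objCoaction D)
      (D.bun.isBundle.ρ 2 1 ≫ objCoaction D) ≫ μ[𝓛.L.obj D.E] :=
  add_comp_snd D.lift_isHom_bun

/-- The top edge of a pullback square with invertible bottom edge is invertible, and then so is the
coaction. -/
instance isIso_objCoaction : IsIso (objCoaction D) := by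
  let V : D.bun.isBundle.pow 2 ⟶ D.E ⊗ 𝓛.L.obj D.E :=
    D.bun.vertical 𝓛.tangentFunctor (.of_iter D.preservesPow) D.lift (𝓛.tangentBun D.E).zero
      (𝓛.tangentBun (𝟙_ C)).zero D.lift_isHom_map.w (𝓛.tangentStructure.bun_naturality D.q).zero
  -- The zeroth iterate of `T` is the identity, so this instance is the square itself.
  have hV : IsPullback V (D.bun.isBundle.ρ 2 0 ≫ D.q) (𝓛.tangentFunctor.map D.q)
    (𝓛.tangentBun (𝟙_ C)).zero := D.universal 0
  have : IsIso V := hV.isIso_fst_of_isIso 𝓛.isIso_tangentBun_unit_zero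
  exact isIso_snd_of_isIso_vertical D.bun (u := objLift D)
    (vertical_fst D.bun (.of_iter D.preservesPow) D.lift_isHom_map.w
      (𝓛.tangentStructure.bun_naturality D.q).zero rfl (objLift_fst D))
    (vertical_snd D.bun (.of_iter D.preservesPow) D.lift_isHom_map.w
      (𝓛.tangentStructure.bun_naturality D.q).zero rfl)

/-- The `L(L(E))`-component of `lift_lift` equates the coaction followed by either side, and the
coaction is epi. -/
theorem map_objCoaction : 𝓛.L.map (objCoaction D) = 𝓛.ν.inv.app D.E := by
  have h : objLift D ≫ (objLift D ⊗ₘ 𝓛.L.map (objLift D)) = objLift D ≫ 𝓛.tangentLift D.E :=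
    D.lift_lift
  have h1 := congrArg (· ≫ snd _ _ ≫ 𝓛.L.map (snd _ _)) h
  simp only [Category.assoc, tangentLift_snd_snd, tensorHom_snd_assoc, ← Functor.map_comp] at h1
  simp only [← Category.assoc] at h1
  exact (cancel_epi (objCoaction D)).1 h1

/-- The `L`-algebra of a differential object. -/
def algebraOf : 𝓛.Algebra where
  A := D.E
  a := (asIso (objCoaction D)).symm
  map_a := by
    have h : 𝓛.ν.inv.app D.E ≫ 𝓛.ν.hom.app D.E = 𝟙 (𝓛.L.obj D.E) := Iso.inv_hom_id_app _ _
    have h' : 𝓛.L.map (objCoaction D) ≫ 𝓛.ν.hom.app D.E = 𝟙 (𝓛.L.obj D.E) := by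
      rw [map_objCoaction]
      exact h
    rw [← cancel_epi (𝓛.L.map (objCoaction D))]
    refine Eq.trans ?_ h'.symm
    simp

end

/-- The first components ask that `f` preserve zero. This follows from the second: after the mono
coaction of `D'`, both zeros become the natural zero of `L`. -/
theorem lift_comm_iff {D D' : DifferentialBundle 𝓛.tangentStructure (𝟙_ C)} (f : D.E ⟶ D'.E) :
    objLift D ≫ (f ⊗ₘ 𝓛.L.map f) = f ≫ objLift D' ↔
      objCoaction D ≫ 𝓛.L.map f = f ≫ objCoaction D' := by
  constructor
  · intro h
    simpa [objCoaction] using congrArg (· ≫ snd _ _) h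
  · intro h
    have hz : D.bun.zero ≫ f = D'.bun.zero := by
      rw [← cancel_mono (objCoaction D'), zero_objCoaction, Category.assoc, ← h, ← Category.assoc,
        zero_objCoaction, zero_map]
    rw [objLift_eq, objLift_eq, lift_map, comp_lift, h, Category.assoc, hz, ← Category.assoc,
      toUnit_unique (f ≫ D'.q) D.q]

variable (𝓛) in
/-- The functor from differential objects to `L`-algebras. -/
def toAlgebra : DifferentialBundle 𝓛.tangentStructure (𝟙_ C) ⥤ 𝓛.Algebra where
  obj D := algebraOf D
  map {D D'} f := ⟨f.hom, by
    have h := (lift_comm_iff f.hom).1 f.lift_comm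
    change 𝓛.L.map f.hom ≫ inv (objCoaction D') = inv (objCoaction D) ≫ f.hom
    rw [IsIso.comp_inv_eq, Category.assoc, ← h, IsIso.inv_hom_id_assoc]⟩
  map_id _ := rfl
  map_comp _ _ := rfl

instance : (toAlgebra 𝓛).Faithful where
  map_injective h := DifferentialBundle.Hom.ext (congrArg Algebra.Hom.hom h)

instance : (toAlgebra 𝓛).Full where
  map_surjective {D D'} := by
    rintro ⟨(f : D.E ⟶ D'.E), h⟩
    replace h : 𝓛.L.map f ≫ inv (objCoaction D') = inv (objCoaction D) ≫ f := h
    rw [IsIso.comp_inv_eq, Category.assoc, IsIso.eq_inv_comp] at h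
    exact ⟨⟨f, toUnit_unique _ _, (lift_comm_iff f).2 h⟩, rfl⟩

/-- The coaction determines the rest: the projection by terminality, the sum and the zero because
the coaction is a mono monoid morphism, the lift by `objLift_eq`. The other fields are propositions.
-/
theorem toAlgebra_obj_injective : Function.Injective (toAlgebra 𝓛).obj := by
  -- With a common object `E`, the two coactions can be compared without transport.
  have key : ∀ {E : C} {q q' : E ⟶ 𝟙_ C} (B : AdditiveBundle q) (B' : AdditiveBundle q')
      (hp hp' l l' h1 h1' h2 h2' h3 h3' h4 h4'),
      objCoaction (𝓛 := 𝓛) ⟨E, q, B, hp, l, h1, h2, h3, h4⟩ =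
        objCoaction (𝓛 := 𝓛) ⟨E, q', B', hp', l', h1', h2', h3', h4'⟩ →
      (⟨E, q, B, hp, l, h1, h2, h3, h4⟩ : DifferentialBundle 𝓛.tangentStructure (𝟙_ C)) =
        ⟨E, q', B', hp', l', h1', h2', h3', h4'⟩ := by
    intro E q q' B B' hp hp' l l' h1 h1' h2 h2' h3 h3' h4 h4' h
    obtain rfl := toUnit_unique q q'
    set D : DifferentialBundle 𝓛.tangentStructure (𝟙_ C) := ⟨E, q, B, hp, l, h1, h2, h3, h4⟩
      with hD
    set D' : DifferentialBundle 𝓛.tangentStructure (𝟙_ C) :=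
      ⟨E, q, B', hp', l', h1', h2', h3', h4'⟩ with hD'
    have hz : B.zero ≫ objCoaction D = B'.zero ≫ objCoaction D :=
      (zero_objCoaction D).trans ((zero_objCoaction D').symm.trans
        (congrArg (B'.zero ≫ ·) h.symm))
    have ha : B.add ≫ objCoaction D = B'.add ≫ objCoaction D := by
      refine (add_objCoaction D).trans (Eq.trans ?_ ((add_objCoaction D').symm.trans
        (congrArg (B'.add ≫ ·) h.symm)))
      rw [← h]
    have hB : B = B' := additiveBundle_ext (objCoaction D) hz ha
    have hl : l = l' := by
      refine (objLift_eq D).trans (Eq.trans ?_ (objLift_eq D').symm)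
      rw [h]
      exact congrArg (fun b : AdditiveBundle q => CartesianMonoidalCategory.lift (q ≫ b.zero) _) hB
    subst hB hl
    rfl
  rintro ⟨E, q, B, hp, l, h1, h2, h3, h4⟩ ⟨E', q', B', hp', l', h1', h2', h3', h4'⟩ h
  obtain rfl : E = E' := congrArg Algebra.A h
  refine key _ _ _ _ _ _ _ _ _ _ _ _ _ _ ?_
  -- Once the objects agree, the heterogeneous equality of structure isomorphisms is an ordinary
  -- one; their inverses are the coactions.
  have ha := eq_of_heq (Algebra.mk.inj h).2
  exact congrArg Iso.inv ha

end LinearAssignment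

/-! ### From algebras to differential objects -/

namespace LinearAssignment

variable {C : Type u} [Category.{v} C] [CartesianMonoidalCategory C] [BraidedCategory C]
  {𝓛 : LinearAssignment C}

/-- Terminality of `T(1)` settles every condition over the base, including commutativity of the
universality square. -/
theorem tangent_unit_ext {W : C} (f g : W ⟶ 𝟙_ C ⊗ 𝓛.L.obj (𝟙_ C)) : f = g :=
  CartesianMonoidalCategory.hom_ext _ _ (toUnit_unique _ _) (𝓛.hom_unit_ext _ _)

variable (A : 𝓛.Algebra)

namespace Algebra

/-- The additive bundle of an `L`-algebra. -/
def bun : AdditiveBundle (toUnit A.A) := toUnitBundle A.a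

theorem preservesPow (m : ℕ) : PreservesPow (iter 𝓛.tangentFunctor m) (toUnit A.A) :=
  haveI := preservesFiniteProducts_iter 𝓛.tangentFunctor m
  preservesPow_toUnit _ _

/-- The lift `⟨0, a⁻¹⟩ : A ⟶ A × L A` of an `L`-algebra. -/
def lift : A.A ⟶ A.A ⊗ 𝓛.L.obj A.A :=
  CartesianMonoidalCategory.lift (toUnit A.A ≫ η[𝓛.L.obj A.A] ≫ A.a.hom) A.a.inv

theorem lift_fst : A.lift ≫ fst _ _ = toUnit A.A ≫ η[𝓛.L.obj A.A] ≫ A.a.hom :=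
  CartesianMonoidalCategory.lift_fst _ _

theorem lift_snd : A.lift ≫ snd _ _ = A.a.inv :=
  CartesianMonoidalCategory.lift_snd _ _

theorem zero_eq : A.bun.zero = η[𝓛.L.obj A.A] ≫ A.a.hom := rfl

theorem pair_add {W : C} (x y : W ⟶ A.A) (h : x ≫ toUnit A.A = y ≫ toUnit A.A) :
    A.bun.isBundle.pair x y h ≫ A.bun.add =
      CartesianMonoidalCategory.lift (x ≫ A.a.inv) (y ≫ A.a.inv) ≫ μ[𝓛.L.obj A.A] ≫ A.a.hom :=
  pair_toUnitBundle_add _ _ _ _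

theorem add_eq : A.bun.add =
    CartesianMonoidalCategory.lift (A.bun.isBundle.ρ 2 0 ≫ A.a.inv)
      (A.bun.isBundle.ρ 2 1 ≫ A.a.inv) ≫ μ[𝓛.L.obj A.A] ≫ A.a.hom := rfl

theorem map_a_inv : 𝓛.L.map A.a.inv = 𝓛.ν.inv.app A.A := by
  have h : 𝓛.ν.inv.app A.A ≫ 𝓛.ν.hom.app A.A = 𝟙 (𝓛.L.obj A.A) := Iso.inv_hom_id_app _ _
  rw [← cancel_mono (𝓛.L.map A.a.hom)]
  refine Eq.trans (by simp) (h.symm.trans ?_)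
  rw [A.map_a]

/-- The monoid structure of `A` is transported along `a`, so `a⁻¹` is additive by construction. -/
theorem lift_isHom_bun : A.bun.IsHom (𝓛.tangentBun A.A) A.lift A.bun.zero where
  w := A.lift_fst
  add := by
    refine (pair_prodSum _ _ _).trans ?_
    apply CartesianMonoidalCategory.hom_ext
    · simp only [Category.assoc, CartesianMonoidalCategory.lift_fst, A.lift_fst, comp_toUnit_assoc]
    · simp only [Category.assoc, CartesianMonoidalCategory.lift_snd, A.lift_snd, add_eq,
        Iso.hom_inv_id, Category.comp_id]
  zero := by
    change A.bun.zero ≫ A.lift = A.bun.zero ≫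
      CartesianMonoidalCategory.lift (𝟙 _) (toUnit _ ≫ η[𝓛.L.obj A.A])
    apply CartesianMonoidalCategory.hom_ext
    · simp [A.lift_fst, zero_eq]
    · simp [A.lift_snd, zero_eq]

/-- The sum of `A` is `a` after the sum of `L(A)` after two copies of `a⁻¹`. Under `L` these become
`ν`, the sum of `L(L(A))` (by `map_sum`) and copies of `ν⁻¹`; as `ν` is additive, the composite is
the sum of `L(A)`. -/
theorem map_add_snd {W : C}
    {k : W ⟶ A.bun.isBundle.pow 2 ⊗ 𝓛.L.obj (A.bun.isBundle.pow 2)}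
    {x y : W ⟶ A.A ⊗ 𝓛.L.obj A.A}
    (hx : k ≫ (A.bun.isBundle.ρ 2 0 ⊗ₘ 𝓛.L.map (A.bun.isBundle.ρ 2 0)) = x)
    (hy : k ≫ (A.bun.isBundle.ρ 2 1 ⊗ₘ 𝓛.L.map (A.bun.isBundle.ρ 2 1)) = y) :
    (k ≫ (A.bun.add ⊗ₘ 𝓛.L.map A.bun.add)) ≫ snd _ _ =
      CartesianMonoidalCategory.lift (x ≫ snd _ _) (y ≫ snd _ _) ≫ μ[𝓛.L.obj A.A] := by
  have h : 𝓛.ν.inv.app A.A ≫ 𝓛.ν.hom.app A.A = 𝟙 (𝓛.L.obj A.A) := Iso.inv_hom_id_app _ _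
  -- The sum in `L(A)` is computed in `L(L(A))` by conjugating with `ν`, to match the shape of `e`.
  have h' : CartesianMonoidalCategory.lift (x ≫ snd _ _) (y ≫ snd _ _) ≫ μ[𝓛.L.obj A.A] =
      CartesianMonoidalCategory.lift ((x ≫ snd _ _) ≫ 𝓛.ν.inv.app A.A)
        ((y ≫ snd _ _) ≫ 𝓛.ν.inv.app A.A) ≫ μ[𝓛.L.obj (𝓛.L.obj A.A)] ≫ 𝓛.ν.hom.app A.A := by
    rw [← reassoc_of% 𝓛.sum_ν_inv]
    refine congrArg (_ ≫ ·) ?_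
    exact ((congrArg (_ ≫ ·) h).trans (Category.comp_id _)).symm
  have e : 𝓛.L.map A.bun.add = CartesianMonoidalCategory.lift
      (𝓛.L.map (A.bun.isBundle.ρ 2 0) ≫ 𝓛.ν.inv.app A.A)
      (𝓛.L.map (A.bun.isBundle.ρ 2 1) ≫ 𝓛.ν.inv.app A.A) ≫
        μ[𝓛.L.obj (𝓛.L.obj A.A)] ≫ 𝓛.ν.hom.app A.A := by
    rw [add_eq, ← Category.assoc, Functor.map_comp, map_sum, A.map_a, Functor.map_comp,
      Functor.map_comp, map_a_inv]
    exact Category.assoc _ _ _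
  have hx' : k ≫ snd _ _ ≫ 𝓛.L.map (A.bun.isBundle.ρ 2 0) = x ≫ snd _ _ := by
    rw [← hx, Category.assoc, tensorHom_snd]
  have hy' : k ≫ snd _ _ ≫ 𝓛.L.map (A.bun.isBundle.ρ 2 1) = y ≫ snd _ _ := by
    rw [← hy, Category.assoc, tensorHom_snd]
  rw [h', Category.assoc, tensorHom_snd, e, comp_lift_assoc, comp_lift_assoc, ← hx', ← hy']
  simp only [Category.assoc]

/-- On first components the claim is `0 + 0 = 0`; on second components it is additivity of `a⁻¹`, by
`map_add_snd`. -/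
theorem lift_isHom_map : A.bun.IsHom (A.bun.map 𝓛.tangentFunctor (.of_iter A.preservesPow))
    A.lift (𝓛.tangentBun (𝟙_ C)).zero where
  w := tangent_unit_ext _ _
  add := by
    refine (A.bun.map_pair_add 𝓛.tangentFunctor (.of_iter A.preservesPow) _ _
      (tangent_unit_ext _ _)).trans ?_
    have h1 : ∀ j, ((A.bun.isBundle.ρ 2 j ≫ A.lift) ≫ fst _ _) ≫ A.a.inv =
        toUnit _ ≫ η[𝓛.L.obj A.A] := fun j => by
      simp only [Category.assoc, reassoc_of% A.lift_fst, Iso.hom_inv_id, Category.comp_id,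
        comp_toUnit_assoc]
    have h2 : ∀ j, (A.bun.isBundle.ρ 2 j ≫ A.lift) ≫ snd _ _ = A.bun.isBundle.ρ 2 j ≫ A.a.inv :=
      fun j => by rw [Category.assoc, A.lift_snd]
    apply CartesianMonoidalCategory.hom_ext
    · refine (map_add_fst A.bun (PreservesPow.pair_ρ0 _ _ _ _ _)
        (PreservesPow.pair_ρ1 _ _ _ _ _)).trans ?_
      refine (A.pair_add _ _ _).trans ?_
      refine (congrArg₂ (fun x y => CartesianMonoidalCategory.lift x y ≫ μ ≫ A.a.hom)
        (h1 0) (h1 1)).trans ?_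
      refine Eq.trans ?_ ((Category.assoc _ _ _).trans
        (congrArg (A.bun.add ≫ ·) A.lift_fst)).symm
      rw [lift_comp_one_left_assoc, Category.assoc, comp_toUnit_assoc]
    · refine (A.map_add_snd (PreservesPow.pair_ρ0 _ _ _ _ _)
        (PreservesPow.pair_ρ1 _ _ _ _ _)).trans ?_
      refine (congrArg₂ (fun x y => CartesianMonoidalCategory.lift x y ≫ μ) (h2 0) (h2 1)).trans ?_
      refine Eq.trans ?_ ((Category.assoc _ _ _).trans
        (congrArg (A.bun.add ≫ ·) A.lift_snd)).symm
      simp only [add_eq, Category.assoc, Iso.hom_inv_id, Category.comp_id]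
  zero := by
    change A.bun.zero ≫ A.lift =
      CartesianMonoidalCategory.lift (𝟙 _) (toUnit _ ≫ η[𝓛.L.obj (𝟙_ C)]) ≫
        (A.bun.zero ⊗ₘ 𝓛.L.map A.bun.zero)
    apply CartesianMonoidalCategory.hom_ext
    · simp [A.lift_fst, zero_eq]
    · simp [A.lift_snd, zero_eq]

/-- All components but the last are zero on both sides; the last is the algebra axiom in the form
`L(a⁻¹) = ν⁻¹`. -/
theorem lift_lift : A.lift ≫ (A.lift ⊗ₘ 𝓛.L.map A.lift) = A.lift ≫ 𝓛.tangentLift A.A := by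
  apply 𝓛.tangent_ext
  · simp only [Category.assoc, tensorHom_fst, tangentLift_fst, reassoc_of% A.lift_fst]
    apply CartesianMonoidalCategory.hom_ext
    · simp [A.lift_fst]
    · simp [A.lift_snd]
  · have h : 𝓛.L.map (toUnit A.A ≫ η[𝓛.L.obj A.A] ≫ A.a.hom) = toUnit _ ≫ η[𝓛.L.obj A.A] := by
      rw [← Category.assoc, Functor.map_comp, map_zero, Category.assoc, zero_map]
    simp only [Category.assoc, tensorHom_snd_assoc, tangentLift_snd_fst, comp_toUnit_assoc,
      ← Functor.map_comp, A.lift_fst, h]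
  · simp only [Category.assoc, tensorHom_snd_assoc, tangentLift_snd_snd, ← Functor.map_comp,
      A.lift_snd, A.map_a_inv]

/-- A commutative square with two invertible parallel edges is a pullback, and every functor
preserves such squares, so all `m` are handled at once. -/
theorem universal (m : ℕ)
    (hu : A.lift ≫ 𝓛.tangentFunctor.map (toUnit A.A) =
      toUnit A.A ≫ (𝓛.tangentBun (𝟙_ C)).zero)
    (hv : (𝓛.tangentBun A.A).zero ≫ 𝓛.tangentFunctor.map (toUnit A.A) =
      toUnit A.A ≫ (𝓛.tangentBun (𝟙_ C)).zero) :
    IsPullback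
      ((iter 𝓛.tangentFunctor m).map (A.bun.vertical 𝓛.tangentFunctor (.of_iter A.preservesPow)
        A.lift (𝓛.tangentBun A.A).zero (𝓛.tangentBun (𝟙_ C)).zero hu hv))
      ((iter 𝓛.tangentFunctor m).map (A.bun.isBundle.ρ 2 0 ≫ toUnit A.A))
      ((iter 𝓛.tangentFunctor m).map (𝓛.tangentFunctor.map (toUnit A.A)))
      ((iter 𝓛.tangentFunctor m).map (𝓛.tangentBun (𝟙_ C)).zero) := by
  have : IsIso (A.lift ≫ snd _ _) := by
    rw [A.lift_snd]
    infer_instance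
  have : IsIso (A.bun.vertical 𝓛.tangentFunctor (.of_iter A.preservesPow)
        A.lift (𝓛.tangentBun A.A).zero (𝓛.tangentBun (𝟙_ C)).zero hu hv) :=
    isIso_vertical A.bun (u := A.lift)
      (vertical_fst A.bun (.of_iter A.preservesPow) hu hv rfl A.lift_fst)
      (vertical_snd A.bun (.of_iter A.preservesPow) hu hv rfl)
  have hz : IsIso (Y := 𝓛.tangentFunctor.obj (𝟙_ C)) (𝓛.tangentBun (𝟙_ C)).zero :=
    𝓛.isIso_tangentBun_unit_zero
  have h : CommSq (A.bun.vertical 𝓛.tangentFunctor (.of_iter A.preservesPow)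
        A.lift (𝓛.tangentBun A.A).zero (𝓛.tangentBun (𝟙_ C)).zero hu hv)
      (A.bun.isBundle.ρ 2 0 ≫ toUnit A.A) (𝓛.tangentFunctor.map (toUnit A.A))
      (𝓛.tangentBun (𝟙_ C)).zero := ⟨tangent_unit_ext _ _⟩
  exact @IsPullback.of_horiz_isIso _ _ _ _ _ _ _ _ _ _ (Functor.map_isIso _ _)
    (@Functor.map_isIso _ _ _ _ _ _ (iter 𝓛.tangentFunctor m) _ hz)
    (h.map (iter 𝓛.tangentFunctor m))

/-- The differential object of an `L`-algebra. -/
def differentialObject : DifferentialBundle 𝓛.tangentStructure (𝟙_ C) where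
  E := A.A
  q := toUnit A.A
  bun := A.bun
  preservesPow := A.preservesPow
  lift := A.lift
  lift_isHom_map := A.lift_isHom_map
  lift_isHom_bun := A.lift_isHom_bun
  lift_lift := A.lift_lift
  universal m := A.universal m _ _

/-- The coaction of `⟨0, a⁻¹⟩` is `a⁻¹`, whose inverse is `a`. -/
theorem algebraOf_differentialObject : algebraOf A.differentialObject = A := by
  have h : (algebraOf A.differentialObject).a = A.a :=
    (Iso.ext_inv (A.lift_snd : objCoaction A.differentialObject = A.a.inv))
  have key : ∀ {X : C} {a a' : 𝓛.L.obj X ≅ X} (ha ha'), a = a' →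
      (⟨X, a, ha⟩ : 𝓛.Algebra) = ⟨X, a', ha'⟩ := by
    rintro X a a' ha ha' rfl
    rfl
  exact key _ _ h

end Algebra

/-! ### The isomorphism of categories -/

theorem nonempty_differentialObject_iso_algebra (𝓛 : LinearAssignment C) :
    Nonempty (Cat.of (DifferentialObject 𝓛.tangentStructure) ≅ Cat.of 𝓛.Algebra) :=
  nonempty_cat_iso (toAlgebra 𝓛)
    ⟨toAlgebra_obj_injective, fun A => ⟨A.differentialObject, A.algebraOf_differentialObject⟩⟩

end LinearAssignment

end TangentCat

end

theorem mainTheorem3 (C : Type u) [Category.{v} C] [CartesianMonoidalCategory C]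
    [BraidedCategory C] :
    (∀ 𝓛 : TangentCat.LinearAssignment C,
      Nonempty (Cat.of (TangentCat.DifferentialObject 𝓛.tangentStructure) ≅
        Cat.of 𝓛.Algebra)) ∧
    (∀ 𝓛 : TangentCat.AdditiveAssignment C,
      Nonempty (Cat.of (TangentCat.DifferentialObject
          𝓛.rosickyTangentStructure.toTangentStructure) ≅
        Cat.of 𝓛.toLinearAssignment.Algebra)) :=
  ⟨TangentCat.LinearAssignment.nonempty_differentialObject_iso_algebra,
    -- Differential objects do not involve the negative, and the tangent structure underlying the
    -- Rosický one is that of the linear assignment.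
    fun 𝓛 => 𝓛.toLinearAssignment.nonempty_differentialObject_iso_algebra⟩
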